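/- Conventions. A vertex operator algebra (VOA) $V$ over $\mathbb{C}$ has Virasoro vector $\omega$, $L_n=\omega_{(n+1)}$, central charge $c$, and is graded by the $L_0$-eigenspaces, $V=\bigoplus_{n\ge 0}V_n$, with $\dim V_n<\infty$ and $V_0=\mathbb{C}\mathbf{1}$; for $v\in V_n$ put $o(v)=v_{(n-1)}$. All VOAs on which designs are based are assumed to be direct sums $\bigoplus_i M_i$ of highest weight modules for their Virasoro algebra, $M_i$ being a quotient of a Verma module $M(c,h_i)$ with $h_i\in\mathbb{Z}_{\ge 0}$; $\pi$ is the projection onto $\bigoplus_{h_i=0}M_i$, the subVOA $V_\omega$ generated by $\omega$, with kernel $\bigoplus_{h_i>0}M_i$. The homogeneous part $X=N_h$ of degree $h$ of a $V$-module $N$ is a conformal design of type $t$-$(c,h)$ (a conformal $t$-design) based on $V$ if $\mathrm{tr}|_X\,o(v)=\mathrm{tr}|_X\,o(\pi(v))$ for all $v\in V_n$, $0\le n\le t$. A module is graded by $\mathbb{Z}+h$ if it is the direct sum of its $L_0$-eigenspaces $N_{h+n}$, $n\in\mathbb{Z}$, these are finite-dimensional, and $N_{h+n}=0$ for $n\ll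 0$. Theorem. Let $V$ be a VOA of central charge $c$ as above whose projection $\pi:V\to V_\omega$ is natural, i.e. $\ker\pi$ contains every Virasoro highest weight vector of positive weight (equivalently, $V_\omega$ is a simple VOA; this is automatic if $V$ is simple). Let $N$ be a $V$-module graded by $\mathbb{Z}+h$. Assume that $\omega',\ \omega-\omega'\in V_2$ generate two commuting Virasoro subVOAs of central charge $c'$ and $c^*=c-c'$. Let $W$ be the commutant of $U=V_{\omega'}$ in $V$, a VOA with Virasoro vector $\omega-\omega'$, and fix a decomposition of $W$ into highest weight modules as above, with associated projection $\pi^*$. Assume that as a $U\otimes W$-module $$N=\bigoplus_{h'\in S}\widetilde M(h')\otimes K(h-h'),$$ where $S\subset\mathbb{C}$ is a finite set, each $\widetilde M(h')\neq 0$ is a $U$-module generated by Virasoro highest weight vectors of degree $h'$, and each $K(h^*)$, $h^*=h-h'$, is a $W$-module graded by $\mathbb{Z}+h^*$. Put $s^*=|S|$. Let $t\ge 0$ be such that $t^*:=t+2-2s^*\ge 0$ and suppose that for all $n\in h-\mathbb{Z}_{\ge 0}$ the homogeneous part $N_n$ is a conformal design of type $t$-$(c,n)$ based on $V$. Then for all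 $h'\in S$ and all integers $k\ge 0$ the derived part $K(h^*)_{h^*-k}$, $h^*=h-h'$, of $X=N_h$ with respect to $\omega'$ is a conformal design of type $t^*$-$(c^*,h^*-k)$ based on $W$ (with respect to $\pi^*$). -/

import Mathlib

open scoped TensorProduct DirectSum

noncomputable section

/-- The Virasoro relations
`[L_m, L_n] = (m - n) L_{m+n} + (m^3 - m)/12 δ_{m+n,0} c` for a family of operators. -/
def IsVirasoro {N : Type*} [AddCommGroup N] [Module ℂ N] (c : ℂ)
    (L : ℤ → Module.End ℂ N) : Prop :=
  ∀ m n : ℤ, L m * L n - L n * L m = ((m : ℂ) - n) • L (m + n) +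
    (if m + n = 0 then ((m : ℂ) ^ 3 - m) / 12 * c else 0) • (1 : Module.End ℂ N)

/-- The smallest subspace which contains `s` and is stable under all operators `L n`. -/
def virSpan {N : Type*} [AddCommGroup N] [Module ℂ N] (L : ℤ → Module.End ℂ N)
    (s : Set N) : Submodule ℂ N :=
  sInf {P | s ⊆ P ∧ ∀ n : ℤ, ∀ x ∈ P, L n x ∈ P}

/-- `x` is zero or a Virasoro highest weight vector of weight `μ`. -/
def IsHighestWeightVector {N : Type*} [AddCommGroup N] [Module ℂ N] (L : ℤ → Module.End ℂ N)
    (μ : ℂ) (x : N) : Prop :=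
  L 0 x = μ • x ∧ ∀ n : ℤ, 0 < n → L n x = 0

/-- The Borcherds (Jacobi) identity in components, for a state-field map `Y` of a vertex algebra
and its action `YN` on a space `N` (`N = V` and `YN = Y` for the vertex algebra itself).
Here `(Y u)_(n) = VertexOperator.ncoeff (Y u) n` is the coefficient of `z^(-n-1)`. All sums are
finite, since vertex operators have values in Laurent series. -/
def BorcherdsIdentity {V N : Type*} [AddCommGroup V] [Module ℂ V] [AddCommGroup N] [Module ℂ N]
    (Y : V →ₗ[ℂ] VertexOperator ℂ V) (YN : V →ₗ[ℂ] VertexOperator ℂ N) : Prop :=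
  ∀ (u v : V) (x : N) (m n p : ℤ),
    ∑ᶠ i : ℕ, (Ring.choose m i : ℤ) •
        VertexOperator.ncoeff (YN (VertexOperator.ncoeff (Y u) (p + i) v)) (m + n - i) x =
      ∑ᶠ i : ℕ, ((-1) ^ i * Ring.choose p i : ℤ) •
        (VertexOperator.ncoeff (YN u) (m + p - i) (VertexOperator.ncoeff (YN v) (n + i) x) -
          (p.negOnePow : ℤ) •
            VertexOperator.ncoeff (YN v) (n + p - i) (VertexOperator.ncoeff (YN u) (m + i) x))

/-- A vertex operator algebra over the complex numbers, graded by the non-negative integers, with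
finite-dimensional homogeneous parts and `V_0 = ℂ 1`. -/
structure VertexOperatorAlgebra (V : Type*) [AddCommGroup V] [Module ℂ V] where
  /-- the state-field map `v ↦ Y(v, z)` -/
  Y : V →ₗ[ℂ] VertexOperator ℂ V
  /-- the vacuum vector -/
  one : V
  /-- the Virasoro vector -/
  ω : V
  /-- the central charge -/
  c : ℂ
  one_ne_zero : one ≠ 0
  ncoeff_one : ∀ n : ℤ, VertexOperator.ncoeff (Y one) n = if n = -1 then 1 else 0
  ncoeff_neg_one_one : ∀ v : V, VertexOperator.ncoeff (Y v) (-1) one = v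
  ncoeff_nonneg_one : ∀ (v : V) (n : ℤ), 0 ≤ n → VertexOperator.ncoeff (Y v) n one = 0
  borcherds : BorcherdsIdentity Y Y
  virasoro : IsVirasoro c fun n => VertexOperator.ncoeff (Y ω) (n + 1)
  /-- `L_{-1}` acts as the derivative: `Y(L_{-1} v, z) = d/dz Y(v, z)` -/
  derivative : ∀ (v : V) (n : ℤ), VertexOperator.ncoeff (Y (VertexOperator.ncoeff (Y ω) 0 v)) n =
    (-n : ℂ) • VertexOperator.ncoeff (Y v) (n - 1)
  /-- `V` is the (automatically direct) sum of the `L_0`-eigenspaces for `0, 1, 2, …` -/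
  iSup_eigenspace : ⨆ n : ℕ, Module.End.eigenspace (VertexOperator.ncoeff (Y ω) 1) (n : ℂ) = ⊤
  finite_eigenspace : ∀ n : ℕ, FiniteDimensional ℂ
    (Module.End.eigenspace (VertexOperator.ncoeff (Y ω) 1) (n : ℂ))
  eigenspace_zero : Module.End.eigenspace (VertexOperator.ncoeff (Y ω) 1) 0 = ℂ ∙ one

namespace VertexOperatorAlgebra

variable {V : Type*} [AddCommGroup V] [Module ℂ V]

/-- The mode `u_(n)` acting on the vertex operator algebra. -/
def mode (A : VertexOperatorAlgebra V) (u : V) (n : ℤ) : Module.End ℂ V :=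
  VertexOperator.ncoeff (A.Y u) n

/-- `L_n = ω_(n+1)`. -/
def L (A : VertexOperatorAlgebra V) (n : ℤ) : Module.End ℂ V := A.mode A.ω (n + 1)

/-- The homogeneous part of degree `μ`. -/
def weightSpace (A : VertexOperatorAlgebra V) (μ : ℂ) : Submodule ℂ V :=
  Module.End.eigenspace (A.L 0) μ

/-- A (weak) module of a vertex operator algebra: vertex operators with values in Laurent series,
the vacuum acting as the identity, and the Jacobi identity. -/
structure WeakModule (A : VertexOperatorAlgebra V) (N : Type*) [AddCommGroup N] [Module ℂ N] where
  Y : V →ₗ[ℂ] VertexOperator ℂ N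
  ncoeff_one : ∀ n : ℤ, VertexOperator.ncoeff (Y A.one) n = if n = -1 then 1 else 0
  borcherds : BorcherdsIdentity A.Y Y

namespace WeakModule

variable {A : VertexOperatorAlgebra V} {N : Type*} [AddCommGroup N] [Module ℂ N]

/-- The mode `u_(n)` acting on the module. -/
def mode (X : A.WeakModule N) (u : V) (n : ℤ) : Module.End ℂ N :=
  VertexOperator.ncoeff (X.Y u) n

/-- `L_n = ω_(n+1)` acting on the module. -/
def L (X : A.WeakModule N) (n : ℤ) : Module.End ℂ N := X.mode A.ω (n + 1)

/-- The homogeneous part `N_μ` of degree `μ`. -/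
def weightSpace (X : A.WeakModule N) (μ : ℂ) : Submodule ℂ N :=
  Module.End.eigenspace (X.L 0) μ

/-- `N` is an (ordinary) module graded by `ℤ + h`: it is the (automatically direct) sum of the
`L_0`-eigenspaces `N_{h+n}`, `n ∈ ℤ`, these are finite-dimensional, and `N_{h-n} = 0` for all
sufficiently large `n`. -/
structure IsGradedBy (X : A.WeakModule N) (h : ℂ) : Prop where
  iSup_weightSpace : ⨆ n : ℤ, X.weightSpace (h + n) = ⊤
  finite_weightSpace : ∀ n : ℤ, FiniteDimensional ℂ (X.weightSpace (h + n))
  bounded : ∃ n₀ : ℤ, ∀ n : ℤ, n < n₀ → X.weightSpace (h + n) = ⊥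

/-- `N` is generated, as a module for the Virasoro algebra of `A`, by highest weight vectors of
degree `μ`. -/
def IsGeneratedByHighestWeight (X : A.WeakModule N) (μ : ℂ) : Prop :=
  virSpan X.L {x | IsHighestWeightVector X.L μ x} = ⊤

end WeakModule

open Classical in
/-- A decomposition of `V` into an (internal) direct sum of Virasoro highest weight modules
`M i`, each generated by a highest weight vector of weight `wt i ∈ {0, 1, 2, …}`, i.e. isomorphic
to a quotient of the Verma module `M(c, wt i)`. -/
structure HighestWeightDecomposition (A : VertexOperatorAlgebra V) where
  ι : Type*
  M : ι → Submodule ℂ V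
  wt : ι → ℕ
  isInternal : DirectSum.IsInternal M
  exists_generator : ∀ i, ∃ v : V, v ≠ 0 ∧ IsHighestWeightVector A.L (wt i) v ∧
    M i = virSpan A.L {v}

namespace HighestWeightDecomposition

variable {A : VertexOperatorAlgebra V}

open Classical in
/-- The projection `π` of `V` onto the sum of the `M i` with `wt i = 0` (which is the subalgebra
`V_ω` generated by `ω`), with kernel the sum of the `M i` with `wt i > 0`. -/
def proj (D : A.HighestWeightDecomposition) : V →ₗ[ℂ] V :=
  DirectSum.toModule ℂ D.ι V (fun i => if D.wt i = 0 then (D.M i).subtype else 0) ∘ₗ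
    (LinearEquiv.ofBijective (DirectSum.coeLinearMap D.M) D.isInternal).symm.toLinearMap

/-- The projection `π` is natural, i.e. independent of the chosen decomposition: its kernel
contains every Virasoro highest weight vector of positive weight. -/
def IsNatural (D : A.HighestWeightDecomposition) : Prop :=
  ∀ (n : ℕ) (v : V), 0 < n → IsHighestWeightVector A.L n v → D.proj v = 0

end HighestWeightDecomposition

end VertexOperatorAlgebra

/-! Elementary consequences of the Borcherds identity, needed to restrict zero modes to homogeneous
parts and to equip the commutant with its vertex operator algebra structure. -/

section Borcherds

variable {V N : Type*} [AddCommGroup V] [Module ℂ V] [AddCommGroup N] [Module ℂ N]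

theorem exists_ncoeff_eq_zero (B : VertexOperator ℂ N) (x : N) :
    ∃ n₀ : ℤ, ∀ n : ℤ, n₀ ≤ n → VertexOperator.ncoeff B n x = 0 := by
  refine ⟨-HahnSeries.order ((HahnModule.of ℂ).symm (B x)), fun n hn => ?_⟩
  apply VertexOperator.ncoeff_eq_zero_of_lt_order
  omega

theorem vertexOperator_ext {A B : VertexOperator ℂ N}
    (h : ∀ n : ℤ, VertexOperator.ncoeff A n = VertexOperator.ncoeff B n) : A = B := by
  apply HVertexOperator.coeff_inj
  ext n x
  have hn := congrArg (fun f => f x) (h (-n - 1))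
  simp only [VertexOperator.ncoeff_apply] at hn
  rwa [show -(-n - 1) - 1 = n by ring] at hn

theorem BorcherdsIdentity.commutator {Y : V →ₗ[ℂ] VertexOperator ℂ V}
    {YN : V →ₗ[ℂ] VertexOperator ℂ N} (hB : BorcherdsIdentity Y YN) (u v : V) (x : N) (m n : ℤ) :
    ∑ᶠ i : ℕ, (Ring.choose m i : ℤ) •
        VertexOperator.ncoeff (YN (VertexOperator.ncoeff (Y u) i v)) (m + n - i) x =
      VertexOperator.ncoeff (YN u) m (VertexOperator.ncoeff (YN v) n x) -
        VertexOperator.ncoeff (YN v) n (VertexOperator.ncoeff (YN u) m x) := by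
  have h := hB u v x m n 0
  simp only [zero_add] at h
  rw [h, finsum_eq_single _ 0]
  · simp
  · intro i hi
    rw [Ring.choose_zero_pos ℤ (Nat.pos_of_ne_zero hi)]
    simp

theorem BorcherdsIdentity.assoc {Y : V →ₗ[ℂ] VertexOperator ℂ V}
    {YN : V →ₗ[ℂ] VertexOperator ℂ N} (hB : BorcherdsIdentity Y YN) (u v : V) (x : N) (n p : ℤ) :
    VertexOperator.ncoeff (YN (VertexOperator.ncoeff (Y u) p v)) n x =
      ∑ᶠ i : ℕ, ((-1) ^ i * Ring.choose p i : ℤ) •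
        (VertexOperator.ncoeff (YN u) (p - i) (VertexOperator.ncoeff (YN v) (n + i) x) -
          (p.negOnePow : ℤ) •
            VertexOperator.ncoeff (YN v) (n + p - i) (VertexOperator.ncoeff (YN u) i x)) := by
  have h := hB u v x 0 n p
  rw [finsum_eq_single _ 0] at h
  · simpa using h
  · intro i hi
    rw [Ring.choose_zero_pos ℤ (Nat.pos_of_ne_zero hi)]
    simp

theorem assoc_support
    (YN : V →ₗ[ℂ] VertexOperator ℂ N) (u v : V) (x : N) (n p : ℤ) :
    (Function.support fun i : ℕ => ((-1) ^ i * Ring.choose p i : ℤ) •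
        (VertexOperator.ncoeff (YN u) (p - i) (VertexOperator.ncoeff (YN v) (n + i) x) -
          (p.negOnePow : ℤ) •
            VertexOperator.ncoeff (YN v) (n + p - i) (VertexOperator.ncoeff (YN u) i x))).Finite := by
  obtain ⟨a, ha⟩ := exists_ncoeff_eq_zero (YN v) x
  obtain ⟨b, hb⟩ := exists_ncoeff_eq_zero (YN u) x
  refine (Set.finite_Iio (max (a - n).toNat b.toNat)).subset fun i hi => ?_
  by_contra hlt
  simp only [Set.mem_Iio, not_lt, max_le_iff] at hlt
  apply hi
  simp only
  rw [ha _ (by omega), hb _ (by omega)]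
  simp

theorem BorcherdsIdentity.L_neg_one {Y : V →ₗ[ℂ] VertexOperator ℂ V}
    {YN : V →ₗ[ℂ] VertexOperator ℂ N} (hB : BorcherdsIdentity Y YN) (e : V)
    (he : ∀ n : ℤ, VertexOperator.ncoeff (YN e) n = if n = -1 then 1 else 0) (v : V) (n : ℤ) :
    VertexOperator.ncoeff (YN (VertexOperator.ncoeff (Y v) (-2) e)) n =
      (-n : ℂ) • VertexOperator.ncoeff (YN v) (n - 1) := by
  have hc : ∀ i : ℕ, ((-1) ^ i * Ring.choose (-2 : ℤ) i : ℤ) = i + 1 := by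
    intro i
    have h1 : Ring.choose ((i : ℤ) + 1) i = i + 1 := by
      have := Ring.choose_natCast (R := ℤ) (i + 1) i
      rw [Nat.choose_succ_self_right] at this
      exact_mod_cast this
    have h2 := Ring.choose_neg (2 : ℤ) i
    rw [show (2 : ℤ) + i - 1 = i + 1 by ring, h1] at h2
    rw [h2]
    have h3 : ((-1 : ℤ) ^ i * (-1) ^ i) = 1 := by rw [← mul_pow]; simp
    simp only [Int.reduceNeg, Units.smul_def, smul_eq_mul,
      Int.coe_negOnePow_natCast]
    linear_combination ((i : ℤ) + 1) * h3
  ext x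
  rw [hB.assoc]
  simp only [hc, he]
  rcases lt_trichotomy n 0 with hn | hn | hn
  · rw [finsum_eq_single _ (-1 - n).toNat]
    · rw [if_pos (by omega), if_neg (by omega),
        show (-2 : ℤ) - ((-1 - n).toNat : ℤ) = n - 1 by omega]
      have : (((-1 - n).toNat : ℤ) + 1) = -n := by omega
      rw [this]
      simp [← Int.cast_smul_eq_zsmul ℂ]
    · intro i hi
      rw [if_neg (by omega), if_neg (by omega)]
      simp
  · subst hn
    rw [finsum_eq_zero_of_forall_eq_zero]
    · simp
    · intro i
      rw [if_neg (by omega), if_neg (by omega)]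
      simp
  · rw [finsum_eq_single _ (n - 1).toNat]
    · rw [if_neg (by omega), if_pos (by omega),
        show (((n - 1).toNat : ℕ) : ℤ) = n - 1 by omega]
      have : (Int.negOnePow (-2) : ℤ) = 1 := by decide
      rw [this]
      simp [← Int.cast_smul_eq_zsmul ℂ]
    · intro i hi
      rw [if_neg (by omega), if_neg (by omega)]
      simp

end Borcherds

namespace VertexOperatorAlgebra

variable {V : Type*} [AddCommGroup V] [Module ℂ V]

/-- The zero mode `o(v) = v_(n-1)`, `v ∈ V_n`, preserves the homogeneous parts of a module. -/
theorem WeakModule.mode_mem_weightSpace {A : VertexOperatorAlgebra V} {N : Type*} [AddCommGroup N]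
    [Module ℂ N] (X : A.WeakModule N) {n : ℕ} {v : V} (hv : v ∈ A.weightSpace n) {μ : ℂ} {x : N}
    (hx : x ∈ X.weightSpace μ) : X.mode v (n - 1) x ∈ X.weightSpace μ := by
  have hv' : VertexOperator.ncoeff (A.Y A.ω) 1 v = (n : ℂ) • v := by
    exact Module.End.mem_eigenspace_iff.1 hv
  have hx' : VertexOperator.ncoeff (X.Y A.ω) 1 x = μ • x := by
    exact Module.End.mem_eigenspace_iff.1 hx
  have hd : VertexOperator.ncoeff (A.Y A.ω) 0 v = VertexOperator.ncoeff (A.Y v) (-2) A.one := by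
    have h := congrArg (fun f => f A.one) (A.derivative v (-1))
    simpa [A.ncoeff_neg_one_one] using h
  have hc := X.borcherds.commutator A.ω v x 1 (n - 1)
  rw [finsum_eq_sum_of_support_subset (s := {0, 1}) _ ?_] at hc
  · rw [Finset.sum_pair (by norm_num)] at hc
    simp only [Nat.cast_zero, Nat.cast_one, Ring.choose_zero_right, Ring.choose_one_right,
      one_smul, hv', hd, X.borcherds.L_neg_one A.one X.ncoeff_one] at hc
    rw [hx'] at hc
    simp only [WeakModule.weightSpace, WeakModule.L, WeakModule.mode, Module.End.mem_eigenspace_iff]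
    have e1 : (1 + ((n : ℤ) - 1) - 0 - 1) = (n : ℤ) - 1 := by ring
    have e2 : (1 + ((n : ℤ) - 1) - 1) = (n : ℤ) - 1 := by ring
    rw [e1, e2] at hc
    rw [zero_add, ← sub_eq_zero, ← map_smul, ← hc]
    simp
  · intro i hi
    by_contra hi'
    simp only [Finset.coe_insert, Finset.coe_singleton, Set.mem_insert_iff,
      Set.mem_singleton_iff, not_or] at hi'
    apply hi
    have := Ring.choose_natCast (R := ℤ) 1 i
    simp only [Nat.cast_one] at this
    simp only
    rw [this, Nat.choose_eq_zero_of_lt (by omega)]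
    simp

/-- The zero mode `o(v) = v_(n-1)` of `v ∈ V_n` as an endomorphism of the homogeneous part
`N_μ`. -/
def WeakModule.zeroMode {A : VertexOperatorAlgebra V} {N : Type*} [AddCommGroup N]
    [Module ℂ N] (X : A.WeakModule N) {n : ℕ} (v : A.weightSpace n) (μ : ℂ) :
    Module.End ℂ (X.weightSpace μ) :=
  (X.mode v (n - 1)).restrict fun _ hx => X.mode_mem_weightSpace v.2 hx

namespace HighestWeightDecomposition

variable {A : VertexOperatorAlgebra V}

open Classical in
theorem proj_apply (D : A.HighestWeightDecomposition) {i : D.ι} {x : V} (hx : x ∈ D.M i) :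
    D.proj x = if D.wt i = 0 then x else 0 := by
  have h : (LinearEquiv.ofBijective (DirectSum.coeLinearMap D.M) D.isInternal).symm x =
      DirectSum.lof ℂ D.ι (fun i => D.M i) i ⟨x, hx⟩ := by
    rw [LinearEquiv.symm_apply_eq]
    exact (DirectSum.coeLinearMap_lof D.M i ⟨x, hx⟩).symm
  rw [proj, LinearMap.comp_apply, LinearEquiv.coe_coe, h, DirectSum.toModule_lof]
  split_ifs <;> simp

theorem proj_L (D : A.HighestWeightDecomposition) (n : ℤ) (x : V) :
    D.proj (A.L n x) = A.L n (D.proj x) := by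
  classical
  have hst : ∀ i, ∀ y ∈ D.M i, A.L n y ∈ D.M i := by
    intro i y hy
    obtain ⟨v, -, -, hM⟩ := D.exists_generator i
    rw [hM] at hy ⊢
    simp only [virSpan, Submodule.mem_sInf] at hy ⊢
    exact fun P hP => hP.2 n y (hy P hP)
  have hx : x ∈ ⨆ i, D.M i := by
    rw [D.isInternal.submodule_iSup_eq_top]; trivial
  induction hx using Submodule.iSup_induction' with
  | mem i y hy =>
    rw [D.proj_apply hy, D.proj_apply (hst i y hy)]
    split_ifs <;> simp
  | zero => simp
  | add y z _ _ hy hz => simp [hy, hz]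

theorem proj_mem_weightSpace (D : A.HighestWeightDecomposition) {μ : ℂ} {x : V}
    (hx : x ∈ A.weightSpace μ) : D.proj x ∈ A.weightSpace μ := by
  simp only [weightSpace, Module.End.mem_eigenspace_iff] at hx ⊢
  rw [← D.proj_L, hx, map_smul]

/-- The homogeneous part `N_h` of the module is a conformal `t`-design (of type `t`-`(c, h)`):
`tr o(v) = tr o(π(v))` on `N_h`, for all `v ∈ V_n` with `0 ≤ n ≤ t`. -/
def IsConformalDesign (D : A.HighestWeightDecomposition) {N : Type*} [AddCommGroup N] [Module ℂ N]
    (X : A.WeakModule N) (t : ℕ) (h : ℂ) : Prop :=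
  ∀ n : ℕ, n ≤ t → ∀ v : A.weightSpace n,
    LinearMap.trace ℂ (X.weightSpace h) (X.zeroMode v h) =
      LinearMap.trace ℂ (X.weightSpace h)
        (X.zeroMode ⟨D.proj v, D.proj_mem_weightSpace v.2⟩ h)

end HighestWeightDecomposition

/-- `P` contains the vacuum and is closed under all products `u_(n) v`. -/
structure IsSubalgebra (A : VertexOperatorAlgebra V) (P : Submodule ℂ V) : Prop where
  one_mem : A.one ∈ P
  mode_mem : ∀ u ∈ P, ∀ v ∈ P, ∀ n : ℤ, A.mode u n v ∈ P

theorem mem_of_sum_mem {P : Submodule ℂ V} {f : Module.End ℂ V} (hf : ∀ x ∈ P, f x ∈ P)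
    (s : Finset ℕ) : ∀ x : ℕ → V, (∀ n ∈ s, x n ∈ Module.End.eigenspace f (n : ℂ)) →
      ∑ n ∈ s, x n ∈ P → ∀ n ∈ s, x n ∈ P := by
  induction s using Finset.induction_on with
  | empty => simp
  | insert a s ha ih =>
    intro x hx hsum
    have key : ∀ n ∈ s, ((n : ℂ) - a) • x n ∈ P := by
      apply ih (fun n => ((n : ℂ) - a) • x n)
      · exact fun n hn => Submodule.smul_mem _ _ (hx n (Finset.mem_insert_of_mem hn))
      · have h := P.sub_mem (hf _ hsum) (P.smul_mem (a : ℂ) hsum)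
        rw [map_sum, Finset.smul_sum, ← Finset.sum_sub_distrib, Finset.sum_insert ha] at h
        have h1 : ∀ n ∈ insert a s, f (x n) - (a : ℂ) • x n = ((n : ℂ) - a) • x n := by
          intro n hn
          rw [Module.End.mem_eigenspace_iff.1 (hx n hn), sub_smul]
        rw [h1 a (Finset.mem_insert_self a s),
          Finset.sum_congr rfl fun n hn => h1 n (Finset.mem_insert_of_mem hn)] at h
        simpa using h
    have hs : ∀ n ∈ s, x n ∈ P := by
      intro n hn
      have hne : (n : ℂ) - a ≠ 0 := by
        rw [sub_ne_zero]
        intro h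
        rw [Nat.cast_injective h] at hn
        exact ha hn
      exact (P.smul_mem_iff hne).1 (key n hn)
    intro n hn
    rcases Finset.mem_insert.1 hn with rfl | hn
    · rw [Finset.sum_insert ha] at hsum
      exact (P.add_mem_iff_left (P.sum_mem hs)).1 hsum
    · exact hs n hn

/-- The restriction of the state-field map to a subalgebra. -/
def restrictY (A : VertexOperatorAlgebra V) {P : Submodule ℂ V} (hP : A.IsSubalgebra P) :
    P →ₗ[ℂ] VertexOperator ℂ P where
  toFun u := VertexOperator.of_coeff
    (fun k => (A.mode u (-k - 1)).restrict fun v hv => hP.mode_mem u u.2 v hv (-k - 1)) <| by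
      intro x
      obtain ⟨n₀, h₀⟩ := exists_ncoeff_eq_zero (A.Y u) (x : V)
      refine ⟨-n₀, fun k hk => ?_⟩
      by_contra hlt
      apply hk
      ext
      exact h₀ (-k - 1) (by omega)
  map_add' u v := by
    apply vertexOperator_ext
    intro n
    ext x
    simp [mode]
  map_smul' a u := by
    apply vertexOperator_ext
    intro n
    ext x
    simp [mode]

theorem coe_ncoeff_restrictY (A : VertexOperatorAlgebra V) {P : Submodule ℂ V}
    (hP : A.IsSubalgebra P) (u v : P) (n : ℤ) :
    (VertexOperator.ncoeff (A.restrictY hP u) n v : V) = A.mode u n v := by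
  simp [restrictY]

/-- A subalgebra `P` with a Virasoro vector `e` of central charge `ce` whose modes `L_{-1}` and
`L_0` agree on `P` with those of `ω`, as a vertex operator algebra. -/
def subVOA (A : VertexOperatorAlgebra V) {P : Submodule ℂ V} (hP : A.IsSubalgebra P) (e : V)
    (ce : ℂ) (he : e ∈ P) (hvir : IsVirasoro ce fun n => A.mode e (n + 1))
    (h0 : ∀ x ∈ P, A.mode e 0 x = A.mode A.ω 0 x) (h1 : ∀ x ∈ P, A.mode e 1 x = A.mode A.ω 1 x) :
    VertexOperatorAlgebra P where
  Y := A.restrictY hP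
  one := ⟨A.one, hP.one_mem⟩
  ω := ⟨e, he⟩
  c := ce
  one_ne_zero := by
    intro h
    exact A.one_ne_zero (congrArg Subtype.val h)
  ncoeff_one n := by
    ext x
    rw [coe_ncoeff_restrictY]
    have := A.ncoeff_one n
    simp only [mode, this]
    split_ifs <;> simp
  ncoeff_neg_one_one v := by
    ext
    rw [coe_ncoeff_restrictY]
    exact A.ncoeff_neg_one_one v
  ncoeff_nonneg_one v n hn := by
    ext
    rw [coe_ncoeff_restrictY]
    exact A.ncoeff_nonneg_one v n hn
  borcherds := by
    intro u v x m n p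
    have hinj : Function.Injective P.subtype.toAddMonoidHom := Subtype.val_injective
    apply hinj
    rw [AddMonoidHom.map_finsum_of_injective _ hinj, AddMonoidHom.map_finsum_of_injective _ hinj]
    simp only [LinearMap.toAddMonoidHom_coe, map_zsmul, map_sub, Submodule.subtype_apply,
      coe_ncoeff_restrictY]
    exact A.borcherds u v x m n p
  virasoro := by
    intro m n
    ext x
    have h := congrArg (fun f => f (x : V)) (hvir m n)
    split_ifs at h ⊢ <;> simpa [coe_ncoeff_restrictY] using h
  derivative v n := by
    ext x
    rw [coe_ncoeff_restrictY, coe_ncoeff_restrictY, h0 _ v.2]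
    have h := congrArg (fun f => f (x : V)) (A.derivative v n)
    simpa [coe_ncoeff_restrictY, mode] using h
  iSup_eigenspace := by
    have hst : ∀ x ∈ P, A.mode A.ω 1 x ∈ P := fun x hx => h1 x hx ▸ hP.mode_mem e he x hx 1
    rw [eq_top_iff]
    rintro ⟨x, hx⟩ -
    have hx' : x ∈ ⨆ n : ℕ, Module.End.eigenspace (A.mode A.ω 1) (n : ℂ) := by
      have := A.iSup_eigenspace
      rw [mode, this]
      trivial
    obtain ⟨f, hf, hsum⟩ := (Submodule.mem_iSup_iff_exists_finsupp _ _).1 hx'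
    have hmem : ∀ n ∈ f.support, f n ∈ P :=
      mem_of_sum_mem hst f.support f (fun n _ => hf n) (by rw [Finsupp.sum] at hsum; rw [hsum]; exact hx)
    have hall : ∀ n, f n ∈ P := by
      intro n
      by_cases hn : n ∈ f.support
      · exact hmem n hn
      · rw [Finsupp.notMem_support_iff.1 hn]
        exact P.zero_mem
    have hxe : (⟨x, hx⟩ : P) = ∑ n ∈ f.support, ⟨f n, hall n⟩ := by
      rw [Finsupp.sum] at hsum
      ext
      simp [hsum]
    rw [hxe]
    refine Submodule.sum_mem _ fun n _ => Submodule.mem_iSup_of_mem n ?_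
    rw [Module.End.mem_eigenspace_iff]
    ext
    rw [coe_ncoeff_restrictY, h1 _ (hall n)]
    exact Module.End.mem_eigenspace_iff.1 (hf n)
  finite_eigenspace n := by
    have hfin := A.finite_eigenspace n
    let g : Module.End.eigenspace (VertexOperator.ncoeff (A.restrictY hP ⟨e, he⟩) 1) (n : ℂ) →ₗ[ℂ]
        Module.End.eigenspace (VertexOperator.ncoeff (A.Y A.ω) 1) (n : ℂ) :=
      P.subtype.restrict fun x hx => by
        have h := congrArg Subtype.val (Module.End.mem_eigenspace_iff.1 hx)
        rw [coe_ncoeff_restrictY, h1 _ x.2] at h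
        exact Module.End.mem_eigenspace_iff.2 h
    refine FiniteDimensional.of_injective g ?_
    intro x y hxy
    have h := congrArg Subtype.val hxy
    exact Subtype.ext (Subtype.ext h)
  eigenspace_zero := by
    ext x
    rw [Module.End.mem_eigenspace_iff]
    have h := Submodule.ext_iff.1 A.eigenspace_zero (x : V)
    rw [Module.End.mem_eigenspace_iff] at h
    rw [Submodule.mem_span_singleton] at h ⊢
    rw [Subtype.ext_iff, coe_ncoeff_restrictY, h1 _ x.2]
    refine h.trans ?_
    simp [Subtype.ext_iff]

/-- The subalgebra generated by a set. -/
def generated (A : VertexOperatorAlgebra V) (s : Set V) : Submodule ℂ V :=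
  sInf {P | s ⊆ P ∧ A.IsSubalgebra P}

/-- The commutant (coset, centralizer) of a set `s`: all `v` with `u_(n) v = 0` for all `u ∈ s` and
`n ≥ 0`. -/
def commutant (A : VertexOperatorAlgebra V) (s : Set V) : Submodule ℂ V where
  carrier := {v | ∀ u ∈ s, ∀ n : ℤ, 0 ≤ n → A.mode u n v = 0}
  add_mem' ha hb u hu n hn := by rw [map_add, ha u hu n hn, hb u hu n hn, add_zero]
  zero_mem' u _ n _ := map_zero _
  smul_mem' a v hv u hu n hn := by rw [map_smul, hv u hu n hn, smul_zero]

theorem isSubalgebra_generated (A : VertexOperatorAlgebra V) (s : Set V) :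
    A.IsSubalgebra (A.generated s) where
  one_mem := by
    simp only [generated, Submodule.mem_sInf]
    exact fun P hP => hP.2.one_mem
  mode_mem u hu v hv n := by
    simp only [generated, Submodule.mem_sInf] at hu hv ⊢
    exact fun P hP => hP.2.mode_mem u (hu P hP) v (hv P hP) n

theorem subset_generated (A : VertexOperatorAlgebra V) (s : Set V) : s ⊆ A.generated s := by
  intro x hx
  simp only [generated, SetLike.mem_coe, Submodule.mem_sInf]
  exact fun P hP => hP.1 hx

theorem mem_commutant_iff (A : VertexOperatorAlgebra V) {s : Set V} {v : V} :
    v ∈ A.commutant s ↔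
      ∀ u ∈ s, ∀ (m n : ℤ) (x : V), A.mode u m (A.mode v n x) = A.mode v n (A.mode u m x) := by
  constructor
  · intro h u hu m n x
    have hc := A.borcherds.commutator u v x m n
    rw [finsum_eq_zero_of_forall_eq_zero] at hc
    · exact (sub_eq_zero.1 hc.symm)
    · intro i
      have h' : VertexOperator.ncoeff (A.Y u) i v = 0 := h u hu i (by omega)
      rw [h']
      simp
  · intro h u hu n hn
    have h' := h u hu n (-1) A.one
    have h1 : A.mode v (-1) A.one = v := A.ncoeff_neg_one_one v
    have h2 : A.mode u n A.one = 0 := A.ncoeff_nonneg_one u n hn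
    rwa [h1, h2, map_zero] at h'

theorem isSubalgebra_commutant (A : VertexOperatorAlgebra V) (s : Set V) :
    A.IsSubalgebra (A.commutant s) where
  one_mem u _ n hn := A.ncoeff_nonneg_one u n hn
  mode_mem v hv w hw p := by
    rw [mem_commutant_iff] at hv hw ⊢
    intro u hu m n x
    have e : ∀ y, A.mode (A.mode v p w) n y = _ := fun y => A.borcherds.assoc v w y n p
    rw [e, e]
    have hfin := assoc_support A.Y v w x n p
    have := AddMonoidHom.map_finsum (A.mode u m).toAddMonoidHom hfin
    refine this.trans (finsum_congr fun i => ?_)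
    have hv' := hv u hu
    have hw' := hw u hu
    simp only [mode] at hv' hw'
    simp only [LinearMap.toAddMonoidHom_coe, map_zsmul, map_sub, mode, hv', hw']

theorem mem_commutant_comm (A : VertexOperatorAlgebra V) {u v : V} :
    u ∈ A.commutant {v} ↔ v ∈ A.commutant {u} := by
  simp only [mem_commutant_iff, Set.mem_singleton_iff, forall_eq]
  exact ⟨fun h m n x => (h n m x).symm, fun h m n x => (h n m x).symm⟩

theorem commutant_generated (A : VertexOperatorAlgebra V) (u v : V) :
    v ∈ A.commutant (A.generated {u}) ↔ v ∈ A.commutant {u} := by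
  constructor
  · exact fun h x hx => h x (A.subset_generated _ hx)
  · intro h x hx
    have hx' : x ∈ A.commutant {v} := by
      simp only [generated, SetLike.mem_coe, Submodule.mem_sInf] at hx
      refine hx _ ⟨?_, A.isSubalgebra_commutant _⟩
      rw [Set.singleton_subset_iff]
      exact A.mem_commutant_comm.2 h
    exact A.mem_commutant_comm.1 hx' x rfl

/-- `ω'` and `ω - ω'` are vectors in `V_2` which generate two commuting Virasoro subalgebras, of
central charges `c'` and `c - c'`. -/
structure IsVirasoroSplitting (A : VertexOperatorAlgebra V) (ω' : V) (c' : ℂ) : Prop where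
  mem_weightSpace : ω' ∈ A.weightSpace 2
  virasoro : IsVirasoro c' fun n => A.mode ω' (n + 1)
  virasoro_sub : IsVirasoro (A.c - c') fun n => A.mode (A.ω - ω') (n + 1)
  commute : ∀ m n : ℤ, Commute (A.mode ω' m) (A.mode (A.ω - ω') n)

namespace IsVirasoroSplitting

variable {A : VertexOperatorAlgebra V} {ω' : V} {c' : ℂ}

theorem mode_sub (n : ℤ) (x : V) :
    A.mode (A.ω - ω') n x = A.mode A.ω n x - A.mode ω' n x := by
  simp [mode]

theorem sub_mem_commutant (h : A.IsVirasoroSplitting ω' c') :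
    A.ω - ω' ∈ A.commutant (A.generated {ω'}) := by
  rw [commutant_generated, mem_commutant_iff]
  rintro u rfl m n x
  exact congrArg (fun f => f x) (h.commute m n).eq

/-- The Virasoro vertex operator algebra `U = V_{ω'}`: the subalgebra generated by `ω'`, with
Virasoro vector `ω'`. -/
def virasoroVOA (h : A.IsVirasoroSplitting ω' c') : VertexOperatorAlgebra (A.generated {ω'}) :=
  have key : ∀ x ∈ A.generated {ω'}, ∀ n : ℤ, 0 ≤ n → A.mode ω' n x = A.mode A.ω n x := by
    intro x hx n hn
    have h1 : A.ω - ω' ∈ A.commutant {x} := fun y hy =>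
      h.sub_mem_commutant y (Set.mem_singleton_iff.1 hy ▸ hx)
    have h2 := A.mem_commutant_comm.1 h1 _ rfl n hn
    rw [mode_sub, sub_eq_zero] at h2
    exact h2.symm
  A.subVOA (A.isSubalgebra_generated {ω'}) ω' c' (A.subset_generated _ rfl) h.virasoro
    (fun x hx => key x hx 0 le_rfl) (fun x hx => key x hx 1 zero_le_one)

/-- The vertex operator algebra `W`: the commutant of `V_{ω'}` in `V`, with Virasoro vector
`ω - ω'`. -/
def commutantVOA (h : A.IsVirasoroSplitting ω' c') :
    VertexOperatorAlgebra (A.commutant (A.generated {ω'})) :=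
  have key : ∀ x ∈ A.commutant (A.generated {ω'}), ∀ n : ℤ, 0 ≤ n →
      A.mode (A.ω - ω') n x = A.mode A.ω n x := by
    intro x hx n hn
    rw [mode_sub, hx ω' (A.subset_generated _ rfl) n hn, sub_zero]
  A.subVOA (A.isSubalgebra_commutant _) (A.ω - ω') (A.c - c') h.sub_mem_commutant h.virasoro_sub
    (fun x hx => key x hx 0 le_rfl) (fun x hx => key x hx 1 zero_le_one)

end IsVirasoroSplitting

end VertexOperatorAlgebra

end

/-! Write a highest weight vector of `W` of weight `s`, with `0 < s ≤ t*`, as `w`, and test the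
designs on the vectors `w ⊗ u = w_(-1) u` with `u = (L'_{-2})^a 1` in `U` and `0 ≤ a < s*`. Their
degree `2a + s` is at most `2(s* - 1) + t* = t`. Naturality of `π` forces `π(w ⊗ u) = 0`
(`proj_mode_eq_zero`), so the design property says that `o(w ⊗ u)` has trace zero on every
`N_{h+k}`, `k ≤ 0`.

In the expansion of `o(w ⊗ u)` only `o(u) o(w)` preserves the eigenvalues of `ω'_(1)`; all other
terms shift them and are traceless (`modeTrace_mode_neg_one`). Hence the sum over `h'` and `j ≥ 0`
of `tr o(u)` on `M̃(h')_{h'+j}` times `tr o(w)` on `K(h*)_{h*+k-j}` vanishes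
(`TensorDecomposition.subTrace_eq_sum`). By induction on `k`, starting below all the gradings, the
terms with `j > 0` are zero. On the lowest part `M̃(h')_{h'}` the operator `o(u)` is the scalar
`p_a(h')`, where `p_a(x) = x (x + 2) ⋯ (x + 2(a - 1))` is monic of degree `a`
(`mode_omegaPow_of_lowest`). The `s*` equations for `a = 0, …, s* - 1` therefore form a Vandermonde
system, and `dim M̃(h')_{h'} · tr o(w) = 0` for each `h'` (`modeTrace_eq_zero`).

It remains to pass from highest weight vectors to all of `ker π*`
(`isConformalDesign_of_highestWeight`). If `o(v)` and `o(L_n v)`, `n ≥ 0`, are traceless in all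
degrees `h + k`, `k ≤ 0`, then cyclicity of the trace makes `o(L_{-m} v)` traceless there as well
(`modeTrace_L_neg_eq_zero`), and an induction on the number of Virasoro operators applied finishes
the proof. The vanishing holds for every highest weight vector of `W` of weight between `1` and
`t*`, so any choice of `π*` is allowed. Both inductions descend through the grading, which is why
the designs are needed in all degrees at most `h`. -/

noncomputable section

/-! ### Traces on subspaces, tensor products and eigenspaces -/

section LinearAlgebra

variable {𝕜 N : Type*} [Field 𝕜] [AddCommGroup N] [Module 𝕜 N]

/-- The trace of the compression of an endomorphism to a subspace `P`, along some projection onto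
`P`. If `f` preserves `P`, this is the trace of the restriction of `f` to `P`. -/
def subTrace (P : Submodule 𝕜 N) : Module.End 𝕜 N →ₗ[𝕜] 𝕜 where
  toFun f := LinearMap.trace 𝕜 P (P.subtype.leftInverse ∘ₗ f ∘ₗ P.subtype)
  map_add' f g := by simp [LinearMap.add_comp, LinearMap.comp_add]
  map_smul' a f := by simp [LinearMap.smul_comp, LinearMap.comp_smul]

/-- The compression is linear in the operator without any proof of invariance, so the individual
terms of a mode expansion can be separated. On an invariant subspace the auxiliary projection does
not matter. -/
theorem subTrace_eq_trace_restrict {P : Submodule 𝕜 N} {f : Module.End 𝕜 N}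
    (hf : ∀ x ∈ P, f x ∈ P) : subTrace P f = LinearMap.trace 𝕜 P (f.restrict hf) := by
  change LinearMap.trace 𝕜 P _ = _
  congr 1
  ext x
  exact congrArg Subtype.val
    (LinearMap.leftInverse_apply_of_inj P.ker_subtype ((f.restrict hf) x))

theorem subTrace_congr {P : Submodule 𝕜 N} {f g : Module.End 𝕜 N} (h : ∀ x ∈ P, f x = g x) :
    subTrace P f = subTrace P g := by
  change LinearMap.trace 𝕜 P _ = LinearMap.trace 𝕜 P _
  congr 1
  ext x
  simp [h x x.2]

theorem subTrace_eq_zero_of_eq_zero {P : Submodule 𝕜 N} {f : Module.End 𝕜 N}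
    (h : ∀ x ∈ P, f x = 0) : subTrace P f = 0 := by
  rw [subTrace_congr (g := 0) (by simpa using h), map_zero]

theorem subTrace_mul_comm {P Q : Submodule 𝕜 N} [FiniteDimensional 𝕜 P] [FiniteDimensional 𝕜 Q]
    {f g : Module.End 𝕜 N} (hf : ∀ x ∈ P, f x ∈ Q) (hg : ∀ x ∈ Q, g x ∈ P) :
    subTrace P (g * f) = subTrace Q (f * g) := by
  have hgf : ∀ x ∈ P, (g * f) x ∈ P := fun x hx => hg _ (hf x hx)
  have hfg : ∀ x ∈ Q, (f * g) x ∈ Q := fun x hx => hf _ (hg x hx)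
  rw [subTrace_eq_trace_restrict hgf, subTrace_eq_trace_restrict hfg]
  exact LinearMap.trace_comp_comm' (f.restrict hf) (g.restrict hg)

/-- An operator which shifts the eigenvalues of another operator has trace zero. -/
theorem subTrace_eq_zero_of_commutator {P : Submodule 𝕜 N} [FiniteDimensional 𝕜 P]
    {Z T : Module.End 𝕜 N} (hZ : ∀ x ∈ P, Z x ∈ P) (hT : ∀ x ∈ P, T x ∈ P) {e : 𝕜} (he : e ≠ 0)
    (h : ∀ x ∈ P, Z (T x) = T (Z x) + e • T x) : subTrace P T = 0 := by
  have h1 : subTrace P (Z * T) = subTrace P (T * Z + e • T) := subTrace_congr h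
  rw [map_add, map_smul, subTrace_mul_comm hT hZ, left_eq_add, smul_eq_mul] at h1
  exact (mul_eq_zero.1 h1).resolve_left he

theorem subTrace_eq_sum {ι : Type*} {P : Submodule 𝕜 N} {Q : ι → Submodule 𝕜 N}
    [∀ i, FiniteDimensional 𝕜 (Q i)] (s : Finset ι) (hQ : iSupIndep Q) (hP : P = ⨆ i ∈ s, Q i)
    {f : Module.End 𝕜 N} (hf : ∀ i, ∀ x ∈ Q i, f x ∈ Q i) :
    subTrace P f = ∑ i ∈ s, subTrace (Q i) f := by
  have hfP : ∀ x ∈ P, f x ∈ P := by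
    rw [hP]
    exact LinearMap.mapsTo_biSup_of_mapsTo (s : Set ι) hf
  rw [subTrace_eq_trace_restrict hfP]
  simp only [fun i => subTrace_eq_trace_restrict (hf i)]
  exact LinearMap.trace_eq_sum_trace_restrict_of_eq_biSup s (hQ.comp Subtype.val_injective) hf P hP

/-- The image of `P ⊗ Q` under a map `φ : M ⊗ K → N`. -/
def tensorImage {M K : Type*} [AddCommGroup M] [Module 𝕜 M] [AddCommGroup K] [Module 𝕜 K]
    (φ : M ⊗[𝕜] K →ₗ[𝕜] N) (P : Submodule 𝕜 M) (Q : Submodule 𝕜 K) : Submodule 𝕜 N :=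
  LinearMap.range (φ ∘ₗ TensorProduct.map P.subtype Q.subtype)

section TensorImage

variable {M K : Type*} [AddCommGroup M] [Module 𝕜 M] [AddCommGroup K] [Module 𝕜 K]
  {φ : M ⊗[𝕜] K →ₗ[𝕜] N} {P : Submodule 𝕜 M} {Q : Submodule 𝕜 K}

theorem tmul_mem_tensorImage {x : M} (hx : x ∈ P) {y : K} (hy : y ∈ Q) :
    φ (x ⊗ₜ y) ∈ tensorImage φ P Q :=
  ⟨⟨x, hx⟩ ⊗ₜ ⟨y, hy⟩, by simp⟩

theorem tensorImage_le {R : Submodule 𝕜 N} (h : ∀ x ∈ P, ∀ y ∈ Q, φ (x ⊗ₜ y) ∈ R) :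
    tensorImage φ P Q ≤ R := by
  rintro _ ⟨z, rfl⟩
  induction z using TensorProduct.induction_on with
  | zero => simp
  | tmul x y => simpa using h x x.2 y y.2
  | add a b ha hb => rw [map_add]; exact R.add_mem ha hb

theorem tensorImage_bot_right : tensorImage φ P ⊥ = ⊥ := by
  rw [eq_bot_iff]
  refine tensorImage_le fun x _ y hy => ?_
  rw [(Submodule.mem_bot 𝕜).1 hy]
  simp

/-- For a fixed nonzero `y` the map `x ↦ φ (x ⊗ y)` is injective by flatness. The homogeneous parts
of the modules `M̃(h')` are not assumed finite-dimensional; this supplies finiteness wherever they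
meet a nonzero part of `K`. -/
theorem finiteDimensional_left_of_tensorImage (hφ : Function.Injective φ)
    [FiniteDimensional 𝕜 (tensorImage φ P Q)] (hQ : Q ≠ ⊥) : FiniteDimensional 𝕜 P := by
  obtain ⟨y, hy, hy0⟩ := Q.ne_bot_iff.1 hQ
  let g : P →ₗ[𝕜] tensorImage φ P Q :=
    (φ ∘ₗ (TensorProduct.mk 𝕜 M K).flip y ∘ₗ P.subtype).codRestrict _
      fun x => tmul_mem_tensorImage x.2 hy
  refine FiniteDimensional.of_injective g ?_
  intro a b hab
  have h1 : φ ((a : M) ⊗ₜ y) = φ ((b : M) ⊗ₜ y) := congrArg Subtype.val hab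
  have h2 := hφ h1
  have hinj : Function.Injective (LinearMap.toSpanSingleton 𝕜 K y) :=
    fun a b hab => smul_left_injective 𝕜 hy0 hab
  have h3 := Module.Flat.lTensor_preserves_injective_linearMap (M := M) _ hinj
  have h4 : (a : M) ⊗ₜ[𝕜] (1 : 𝕜) = (b : M) ⊗ₜ[𝕜] (1 : 𝕜) := h3 (by simpa using h2)
  have h5 := congrArg (TensorProduct.rid 𝕜 M) h4
  simp only [TensorProduct.rid_tmul, one_smul] at h5
  exact Subtype.ext h5

theorem subTrace_tensorImage (hφ : Function.Injective φ) [FiniteDimensional 𝕜 (tensorImage φ P Q)]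
    [FiniteDimensional 𝕜 Q] {f : Module.End 𝕜 N} {f₁ : Module.End 𝕜 M} {f₂ : Module.End 𝕜 K}
    (h₁ : ∀ x ∈ P, f₁ x ∈ P) (h₂ : ∀ x ∈ Q, f₂ x ∈ Q)
    (h : ∀ x ∈ P, ∀ y ∈ Q, f (φ (x ⊗ₜ y)) = φ (f₁ x ⊗ₜ f₂ y)) :
    subTrace (tensorImage φ P Q) f = subTrace P f₁ * subTrace Q f₂ := by
  -- For `Q = ⊥` nothing bounds `P`, but both sides are zero whatever value the trace on `P` takes.
  rcases eq_or_ne Q ⊥ with rfl | hQ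
  · have h0 : subTrace (⊥ : Submodule 𝕜 K) f₂ = 0 := subTrace_eq_zero_of_eq_zero (by simp)
    rw [h0, mul_zero]
    apply subTrace_eq_zero_of_eq_zero
    rw [tensorImage_bot_right]
    simp
  have hP : FiniteDimensional 𝕜 P := finiteDimensional_left_of_tensorImage hφ hQ
  have hinj : Function.Injective (φ ∘ₗ TensorProduct.map P.subtype Q.subtype) :=
    hφ.comp (TensorProduct.map_injective_of_flat_flat _ _ P.subtype_injective Q.subtype_injective)
  let e : (P ⊗[𝕜] Q) ≃ₗ[𝕜] tensorImage φ P Q := LinearEquiv.ofInjective _ hinj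
  have hf : ∀ x ∈ tensorImage φ P Q, f x ∈ tensorImage φ P Q := by
    have : tensorImage φ P Q ≤ (tensorImage φ P Q).comap f := tensorImage_le fun x hx y hy => by
      rw [Submodule.mem_comap, h x hx y hy]
      exact tmul_mem_tensorImage (h₁ x hx) (h₂ y hy)
    exact this
  rw [subTrace_eq_trace_restrict hf, subTrace_eq_trace_restrict h₁, subTrace_eq_trace_restrict h₂,
    ← LinearMap.trace_tensorProduct', ← LinearMap.trace_conj' _ e]
  congr 1
  ext z
  obtain ⟨w, rfl⟩ := e.surjective z
  rw [LinearEquiv.conj_apply_apply, LinearEquiv.symm_apply_apply]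
  induction w using TensorProduct.induction_on with
  | zero => simp
  | tmul x y => exact h x x.2 y y.2
  | add a b ha hb => simp only [map_add, Submodule.coe_add, ha, hb]

end TensorImage

/-- If the subspaces `P b` lie in eigenspaces of `f`, then an eigenvector in their sum lies in the
sum of those `P b` which belong to its eigenvalue. -/
theorem mem_iSup_of_mem_eigenspace {ι : Type*} {f : Module.End 𝕜 N} {P : ι → Submodule 𝕜 N}
    {ev : ι → 𝕜} (hP : ∀ b, P b ≤ f.eigenspace (ev b)) {μ : 𝕜} {x : N} (hx : x ∈ ⨆ b, P b)
    (hxμ : x ∈ f.eigenspace μ) : x ∈ ⨆ (b) (_ : ev b = μ), P b := by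
  have hle : ⨆ b, P b ≤ (⨆ (b) (_ : ev b = μ), P b) ⊔ ⨆ (b) (_ : ev b ≠ μ), P b := by
    refine iSup_le fun b => ?_
    by_cases hb : ev b = μ
    · exact le_sup_of_le_left (le_iSup₂_of_le b hb le_rfl)
    · exact le_sup_of_le_right (le_iSup₂_of_le b hb le_rfl)
  obtain ⟨q, hq, r, hr, rfl⟩ := Submodule.mem_sup.1 (hle hx)
  have hqμ : q ∈ f.eigenspace μ :=
    (iSup₂_le fun b hb => hb ▸ hP b : (⨆ (b) (_ : ev b = μ), P b) ≤ _) hq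
  have hrμ : r ∈ f.eigenspace μ := by simpa using Submodule.sub_mem _ hxμ hqμ
  have hr' : r ∈ ⨆ (ν) (_ : ν ≠ μ), f.eigenspace ν :=
    (iSup₂_le fun b hb => le_iSup₂_of_le (ev b) hb (hP b) :
      (⨆ (b) (_ : ev b ≠ μ), P b) ≤ _) hr
  -- The remainder `r` is an eigenvector for `μ` and also a sum of eigenvectors for other
  -- eigenvalues, hence zero.
  have := (f.eigenspaces_iSupIndep μ).le_bot ⟨hrμ, hr'⟩
  rw [(Submodule.mem_bot 𝕜).1 this, add_zero]
  exact hq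

/-- The values of monic polynomials of degrees `0, …, |S| - 1` at the points of `S` form an
invertible matrix. -/
theorem eq_zero_of_sum_eval_mul_eq_zero {S : Finset 𝕜} (p : ℕ → Polynomial 𝕜)
    (hp : ∀ n, (p n).Monic) (hd : ∀ n, (p n).natDegree = n) (x : S → 𝕜)
    (h : ∀ n < S.card, ∑ i : S, (p n).eval (i : 𝕜) * x i = 0) (i : S) : x i = 0 := by
  let e := S.equivFin
  let v : Fin S.card → 𝕜 := fun k => (e.symm k : 𝕜)
  -- Column operations reduce monic polynomials of degrees `0, 1, …` to the monomials, so this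
  -- determinant is the Vandermonde determinant of distinct points.
  have hdet : (Matrix.of fun i j : Fin S.card => (p j).eval (v i)).det ≠ 0 := by
    rw [← Matrix.det_eval_matrixOfPolynomials_eq_det_vandermonde v (fun j => p j)
      (fun j => hd j) fun j => hp j, Matrix.det_vandermonde_ne_zero_iff]
    exact Subtype.val_injective.comp e.symm.injective
  have hz := Matrix.eq_zero_of_vecMul_eq_zero (v := fun k => x (e.symm k)) hdet (by
    ext j
    simp only [Matrix.vecMul, dotProduct, Matrix.of_apply, Pi.zero_apply]
    rw [← h j j.2, ← e.symm.sum_comp]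
    exact Finset.sum_congr rfl fun k _ => mul_comm _ _)
  simpa using congrFun hz (e i)

end LinearAlgebra


/-! ### Virasoro operators and modes on modules -/

/-- A weak form of the triangular decomposition. In the smallest subspace `G` that contains `s` and
is stable under the nonpositive modes, the vectors sent into `G` by all positive modes form a
subspace `R`. It contains `s`, and the commutation relation makes it stable under the nonpositive
modes, so `R = G` and `G` is stable under all modes. -/
theorem virSpan_le {N : Type*} [AddCommGroup N] [Module ℂ N] {L : ℤ → Module.End ℂ N}
    (hL : ∀ m n : ℤ, ∃ a b : ℂ, ∀ x, L m (L n x) = L n (L m x) + a • L (m + n) x + b • x)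
    {s : Set N} (hs : ∀ x ∈ s, ∀ n : ℤ, 0 < n → L n x = 0) {Q : Submodule ℂ N} (hsQ : s ⊆ Q)
    (hQ : ∀ n : ℤ, n ≤ 0 → ∀ x ∈ Q, L n x ∈ Q) : virSpan L s ≤ Q := by
  let G : Submodule ℂ N := sInf {P | s ⊆ P ∧ ∀ n : ℤ, n ≤ 0 → ∀ x ∈ P, L n x ∈ P}
  have hGQ : G ≤ Q := sInf_le ⟨hsQ, hQ⟩
  have hsG : s ⊆ G := fun x hx => by
    simp only [G, SetLike.mem_coe, Submodule.mem_sInf]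
    exact fun P hP => hP.1 hx
  have hG : ∀ n : ℤ, n ≤ 0 → ∀ x ∈ G, L n x ∈ G := fun n hn x hx => by
    simp only [G, Submodule.mem_sInf] at hx ⊢
    exact fun P hP => hP.2 n hn x (hx P hP)
  let R : Submodule ℂ N := G ⊓ ⨅ (n : ℤ) (_ : 0 < n), G.comap (L n)
  have hR : ∀ x, x ∈ R ↔ x ∈ G ∧ ∀ n : ℤ, 0 < n → L n x ∈ G := fun x => by
    simp [R, Submodule.mem_iInf]
  have hGR : G ≤ R := by
    refine sInf_le ⟨fun x hx => (hR x).2 ⟨hsG hx, fun n hn => ?_⟩, fun m hm x hx => ?_⟩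
    · rw [hs x hx n hn]
      exact G.zero_mem
    · rw [hR] at hx ⊢
      refine ⟨hG m hm x hx.1, fun n hn => ?_⟩
      obtain ⟨a, b, hab⟩ := hL n m
      rw [hab]
      refine G.add_mem (G.add_mem (hG m hm _ (hx.2 n hn)) (G.smul_mem _ ?_)) (G.smul_mem _ hx.1)
      rcases le_or_gt (n + m) 0 with h | h
      · exact hG _ h x hx.1
      · exact hx.2 _ h
  refine (sInf_le ⟨hsG, fun n x hx => ?_⟩ : virSpan L s ≤ G).trans hGQ
  rcases le_or_gt n 0 with h | h
  · exact hG n h x hx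
  · exact ((hR x).1 (hGR hx)).2 n h

namespace VertexOperatorAlgebra

variable {V : Type*} [AddCommGroup V] [Module ℂ V]

/-- A vertex operator algebra as a module over itself. -/
def adjoint (A : VertexOperatorAlgebra V) : A.WeakModule V where
  Y := A.Y
  ncoeff_one := A.ncoeff_one
  borcherds := A.borcherds

theorem mode_neg_one_one (A : VertexOperatorAlgebra V) (v : V) : A.mode v (-1) A.one = v :=
  A.ncoeff_neg_one_one v

theorem mode_nonneg_one (A : VertexOperatorAlgebra V) (v : V) {n : ℤ} (hn : 0 ≤ n) :
    A.mode v n A.one = 0 :=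
  A.ncoeff_nonneg_one v n hn

theorem mem_weightSpace_iff (A : VertexOperatorAlgebra V) {μ : ℂ} {v : V} :
    v ∈ A.weightSpace μ ↔ A.mode A.ω 1 v = μ • v :=
  Module.End.mem_eigenspace_iff

theorem mode_zero_eq (A : VertexOperatorAlgebra V) (v : V) :
    A.mode A.ω 0 v = A.mode v (-2) A.one := by
  have h := congrArg (fun f => f A.one) (A.derivative v (-1))
  simpa [mode, A.ncoeff_neg_one_one] using h

theorem one_mem_weightSpace (A : VertexOperatorAlgebra V) : A.one ∈ A.weightSpace 0 := by
  rw [mem_weightSpace_iff, A.mode_nonneg_one _ zero_le_one, zero_smul]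

theorem L_comm (A : VertexOperatorAlgebra V) (m n : ℤ) (x : V) :
    A.L m (A.L n x) = A.L n (A.L m x) + ((m : ℂ) - n) • A.L (m + n) x +
      (if m + n = 0 then ((m : ℂ) ^ 3 - m) / 12 * A.c else 0) • x := by
  have h := congrArg (fun f => f x) (A.virasoro m n)
  change A.L m (A.L n x) - A.L n (A.L m x) = _ at h
  rw [sub_eq_iff_eq_add'] at h
  rw [h, add_assoc]
  rfl

theorem L_one (A : VertexOperatorAlgebra V) {n : ℤ} (hn : -1 ≤ n) : A.L n A.one = 0 :=
  A.mode_nonneg_one _ (by omega)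

theorem L_neg_two_one (A : VertexOperatorAlgebra V) : A.L (-2) A.one = A.ω :=
  A.mode_neg_one_one A.ω

theorem ω_mem_weightSpace (A : VertexOperatorAlgebra V) : A.ω ∈ A.weightSpace 2 := by
  rw [weightSpace, Module.End.mem_eigenspace_iff, ← L_neg_two_one, L_comm, A.L_one (by norm_num)]
  norm_num

/-- These are the products `L_{i+1} L_{-2} 1`. Among them only `ω_(3) ω = (c/2) 1` survives, which
is the source of the central term on modules. -/
theorem mode_ω_ω (A : VertexOperatorAlgebra V) (i : ℕ) :
    A.mode A.ω (i + 2) A.ω = (if i = 1 then A.c / 2 else 0) • A.one := by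
  have h := A.L_comm (i + 1) (-2) A.one
  rw [L_neg_two_one, A.L_one (n := i + 1) (by omega), A.L_one (n := i + 1 + -2) (by omega), L,
    show (i : ℤ) + 1 + 1 = i + 2 by ring] at h
  rw [h]
  rcases eq_or_ne i 1 with rfl | hi
  · norm_num
    congr 1
    ring
  · rw [if_neg (by omega), if_neg hi]
    simp

theorem weightSpace_eq_bot (A : VertexOperatorAlgebra V) {μ : ℂ} (hμ : ∀ n : ℕ, (n : ℂ) ≠ μ) :
    A.weightSpace μ = ⊥ := by
  rw [eq_bot_iff]
  intro x hx
  have h : x ∈ ⨆ n : ℕ, Module.End.eigenspace (A.L 0) (n : ℂ) := by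
    have h := A.iSup_eigenspace
    change ⨆ n : ℕ, Module.End.eigenspace (A.L 0) (n : ℂ) = ⊤ at h
    rw [h]
    trivial
  have := mem_iSup_of_mem_eigenspace (fun _ => le_rfl) h hx
  simpa [hμ] using this

namespace WeakModule

variable {A : VertexOperatorAlgebra V} {N : Type*} [AddCommGroup N] [Module ℂ N]
  (X : A.WeakModule N)

theorem mem_weightSpace_iff {μ : ℂ} {x : N} :
    x ∈ X.weightSpace μ ↔ X.mode A.ω 1 x = μ • x :=
  Module.End.mem_eigenspace_iff

theorem mode_add (u v : V) (n : ℤ) : X.mode (u + v) n = X.mode u n + X.mode v n := by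
  simp [mode]

theorem mode_smul (a : ℂ) (v : V) (n : ℤ) : X.mode (a • v) n = a • X.mode v n := by
  simp [mode]

theorem mode_zero (n : ℤ) : X.mode 0 n = 0 := by
  simp [mode]

theorem mode_vacuum (n : ℤ) : X.mode A.one n = if n = -1 then 1 else 0 :=
  X.ncoeff_one n

/-- The commutator formula. -/
theorem commutator (u v : V) (x : N) (m n : ℤ) :
    X.mode u m (X.mode v n x) - X.mode v n (X.mode u m x) =
      ∑ᶠ i : ℕ, (Ring.choose m i : ℤ) • X.mode (A.mode u i v) (m + n - i) x :=
  (X.borcherds.commutator u v x m n).symm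

theorem mode_derivative (v : V) (n : ℤ) :
    X.mode (A.mode A.ω 0 v) n = (-n : ℂ) • X.mode v (n - 1) := by
  rw [mode_zero_eq]
  exact X.borcherds.L_neg_one A.one X.ncoeff_one v n

theorem mode_zero_commutator (u v : V) (x : N) (n : ℤ) :
    X.mode u 0 (X.mode v n x) = X.mode v n (X.mode u 0 x) + X.mode (A.mode u 0 v) n x := by
  rw [← sub_eq_iff_eq_add', commutator, finsum_eq_single _ 0]
  · simp
  · intro i hi
    rw [Ring.choose_zero_pos ℤ (Nat.pos_of_ne_zero hi), zero_smul]

theorem mode_one_commutator (u v : V) (x : N) (n : ℤ) :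
    X.mode u 1 (X.mode v n x) = X.mode v n (X.mode u 1 x) + (X.mode (A.mode u 0 v) (n + 1) x +
      X.mode (A.mode u 1 v) n x) := by
  rw [← sub_eq_iff_eq_add', commutator, finsum_eq_sum_of_support_subset (s := {0, 1})]
  · rw [Finset.sum_pair (by norm_num)]
    simp [add_comm]
  · intro i hi
    by_contra hi'
    simp only [Finset.coe_insert, Finset.coe_singleton, Set.mem_insert_iff,
      Set.mem_singleton_iff, not_or] at hi'
    apply hi
    have := Ring.choose_natCast (R := ℤ) 1 i
    simp only [Nat.cast_one] at this
    simp only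
    rw [this, Nat.choose_eq_zero_of_lt (by omega)]
    simp

/-- If `u_(0)` and `u_(1)` act on `v` like `L_{-1}` and the scalar `d`, then `v_(n)` shifts the
eigenvalues of `u_(1)` by `d - n - 1`. -/
theorem mode_one_mode {u v : V} {d : ℂ} (h₀ : A.mode u 0 v = A.mode A.ω 0 v)
    (h₁ : A.mode u 1 v = d • v) (n : ℤ) (x : N) :
    X.mode u 1 (X.mode v n x) = X.mode v n (X.mode u 1 x) + (d - n - 1) • X.mode v n x := by
  rw [mode_one_commutator, h₀, h₁, mode_derivative, mode_smul]
  simp only [LinearMap.smul_apply, add_sub_cancel_right, ← add_smul]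
  congr 2
  push_cast
  ring

theorem mode_mem {d : ℂ} {v : V} (hv : v ∈ A.weightSpace d) (n : ℤ) {μ ν : ℂ} {x : N}
    (hx : x ∈ X.weightSpace μ) (hν : μ + d - n - 1 = ν) : X.mode v n x ∈ X.weightSpace ν := by
  rw [mem_weightSpace_iff] at hx ⊢
  rw [X.mode_one_mode rfl (A.mem_weightSpace_iff.1 hv), hx, map_smul, ← add_smul, ← hν]
  congr 1
  ring

theorem L_mem (n : ℤ) {μ ν : ℂ} {x : N} (hx : x ∈ X.weightSpace μ) (hν : μ - n = ν) :
    X.L n x ∈ X.weightSpace ν :=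
  X.mode_mem A.ω_mem_weightSpace (n + 1) hx (by rw [← hν]; push_cast; ring)

/-- The Virasoro relation on a module is not an axiom of `WeakModule` but follows from the
commutator formula and the products `ω_(i) ω`, `i ≤ 3`. Stability arguments need only the shape of
the relation, so the constants are left existential. -/
theorem exists_L_comm (m n : ℤ) : ∃ a b : ℂ, ∀ x : N,
    X.L m (X.L n x) = X.L n (X.L m x) + a • X.L (m + n) x + b • x := by
  have h : ∀ x : N, X.L m (X.L n x) - X.L n (X.L m x) = _ :=
    fun x => X.commutator A.ω A.ω x (m + 1) (n + 1)
  have h1 : A.mode A.ω 1 A.ω = (2 : ℂ) • A.ω := A.mem_weightSpace_iff.1 A.ω_mem_weightSpace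
  refine ⟨(m : ℂ) - n, (Ring.choose (m + 1) 3 : ℤ) • (if m + n = 0 then A.c / 2 else 0),
    fun x => ?_⟩
  rw [add_assoc, ← sub_eq_iff_eq_add', h, finsum_eq_sum_of_support_subset (s := Finset.range 4)]
  · have e1 : m + 1 + (n + 1) - 1 = m + n + 1 := by ring
    have h2 := A.mode_ω_ω 0
    have h3 := A.mode_ω_ω 1
    norm_num at h2 h3
    simp only [Finset.sum_range_succ, Finset.sum_range_zero, Nat.cast_zero, Nat.cast_one,
      Nat.cast_ofNat, Ring.choose_zero_right, Ring.choose_one_right, zero_add, h1, h2, h3,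
      mode_derivative, mode_smul, mode_zero, mode_vacuum, sub_zero, e1, L,
      ← Int.cast_smul_eq_zsmul ℂ, LinearMap.smul_apply, LinearMap.zero_apply, smul_zero, add_zero,
      smul_smul, ← add_smul, smul_eq_mul]
    congr 1
    · congr 1
      push_cast
      ring
    · by_cases hmn : m + n = 0
      · rw [if_pos (by omega), if_pos hmn]
        simp
      · rw [if_neg (by omega), if_neg hmn]
        simp
  · intro i hi
    by_contra hi'
    simp only [Finset.coe_range, Set.mem_Iio, not_lt] at hi'
    apply hi
    obtain ⟨j, rfl⟩ := Nat.exists_eq_add_of_le hi'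
    have := A.mode_ω_ω (j + 2)
    rw [if_neg (by omega), zero_smul] at this
    have e : ((4 + j : ℕ) : ℤ) = ((j + 2 : ℕ) : ℤ) + 2 := by push_cast; ring
    simp only
    rw [e, this, mode_zero]
    simp

theorem mode_neg_one_mode (u v : V) (n : ℤ) (x : N) :
    X.mode (A.mode u (-1) v) n x = ∑ᶠ i : ℕ, (X.mode u (-1 - i) (X.mode v (n + i) x) +
      X.mode v (n - 1 - i) (X.mode u i x)) := by
  refine (X.borcherds.assoc u v x n (-1)).trans (finsum_congr fun i => ?_)
  have h : ((-1 : ℤ) ^ i * Ring.choose (-1 : ℤ) i) = 1 := by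
    have h2 := Ring.choose_neg (1 : ℤ) i
    rw [show (1 : ℤ) + i - 1 = i by ring] at h2
    have h3 := Ring.choose_natCast (R := ℤ) i i
    rw [Nat.choose_self] at h3
    rw [h2, h3]
    simp [Units.smul_def, Int.coe_negOnePow_natCast, ← mul_pow]
  rw [h, one_smul]
  simp [mode, sub_eq_add_neg]

/-- The action of `(L_{-2} u)_(d+1)` on a lowest weight space, for `u` of degree `d`. -/
theorem mode_L_neg_two_of_lowest {μ : ℂ} (hμ : ∀ j : ℕ, X.weightSpace (μ - (j + 1)) = ⊥) {d : ℤ}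
    {u : V} (hu : u ∈ A.weightSpace d) {x : N} (hx : x ∈ X.weightSpace μ) :
    X.mode (A.mode A.ω (-1) u) (d + 1) x = (d + μ) • X.mode u (d - 1) x := by
  have hbot : ∀ (j : ℕ) (y : N), y ∈ X.weightSpace (μ - (j + 1)) → y = 0 := fun j y hy => by
    rwa [hμ j, Submodule.mem_bot] at hy
  have hfirst : ∀ i : ℕ, X.mode u (d + 1 + i) x = 0 := fun i =>
    hbot (i + 1) _ (X.mode_mem hu _ hx (by push_cast; ring))
  have hsecond : ∀ i : ℕ, 2 ≤ i → X.mode A.ω i x = 0 := fun i hi => by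
    obtain ⟨j, rfl⟩ := Nat.exists_eq_add_of_le hi
    exact hbot j _ (X.mode_mem A.ω_mem_weightSpace _ hx (by push_cast; ring))
  rw [mode_neg_one_mode, finsum_eq_sum_of_support_subset (s := {0, 1})]
  · rw [Finset.sum_pair (by norm_num), hfirst, hfirst]
    -- The term `i = 0` is `u_(d) L_{-1} x`. As `u_(d) x` lies below the lowest degree, it equals
    -- `-(L_{-1} u)_(d) x = d u_(d-1) x`; the term `i = 1` contributes `μ` through `L_0`.
    have h0 := X.mode_zero_commutator A.ω u x d
    have h00 : X.mode u d x = 0 := hbot 0 _ (X.mode_mem hu _ hx (by push_cast; ring))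
    rw [h00, mode_derivative, map_zero] at h0
    have h1 := X.mem_weightSpace_iff.1 hx
    simp only [map_zero, zero_add, Nat.cast_zero, Nat.cast_one, h1, map_smul, sub_zero, add_smul,
      add_sub_cancel_right]
    congr 1
    rw [← sub_eq_zero, h0]
    simp
    abel
  · intro i hi
    by_contra hi'
    simp only [Finset.coe_insert, Finset.coe_singleton, Set.mem_insert_iff,
      Set.mem_singleton_iff, not_or] at hi'
    apply hi
    simp only
    rw [hfirst, hsecond i (by omega)]
    simp

variable {X}

theorem IsGradedBy.exists_mode_eq_zero {h : ℂ} (hX : X.IsGradedBy h) {d : ℤ} {v : V}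
    (hv : v ∈ A.weightSpace d) (k : ℤ) :
    ∃ q₀ : ℤ, ∀ q, q₀ ≤ q → ∀ x ∈ X.weightSpace (h + k), X.mode v q x = 0 := by
  obtain ⟨n₀, hn₀⟩ := hX.bounded
  refine ⟨k + d - n₀, fun q hq x hx => ?_⟩
  have := X.mode_mem hv q hx (ν := h + ((k + d - q - 1 : ℤ) : ℂ)) (by push_cast; ring)
  rwa [hn₀ _ (by omega), Submodule.mem_bot] at this

theorem iSup_weightSpace_mode_mem {μ : ℂ} {n : ℤ} (hn : n ≤ 0) {x : N}
    (hx : x ∈ ⨆ j : ℕ, X.weightSpace (μ + j)) : X.L n x ∈ ⨆ j : ℕ, X.weightSpace (μ + j) := by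
  obtain ⟨m, rfl⟩ : ∃ m : ℕ, n = -m := ⟨n.natAbs, by omega⟩
  have : ⨆ j : ℕ, X.weightSpace (μ + j) ≤ (⨆ j : ℕ, X.weightSpace (μ + j)).comap (X.L (-m)) :=
    iSup_le fun j y hy => Submodule.mem_iSup_of_mem (j + m) (X.L_mem (-m) hy (by push_cast; ring))
  exact this hx

theorem IsGeneratedByHighestWeight.iSup_weightSpace {μ : ℂ} (hX : X.IsGeneratedByHighestWeight μ) :
    ⨆ j : ℕ, X.weightSpace (μ + j) = ⊤ := by
  rw [eq_top_iff, ← hX]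
  refine virSpan_le X.exists_L_comm (fun x hx => hx.2) (fun x hx => ?_)
    fun n hn x => iSup_weightSpace_mode_mem hn
  exact Submodule.mem_iSup_of_mem 0 (Module.End.mem_eigenspace_iff.2 (by simpa using hx.1))

theorem IsGeneratedByHighestWeight.weightSpace_eq_bot {μ : ℂ}
    (hX : X.IsGeneratedByHighestWeight μ) (j : ℕ) : X.weightSpace (μ - (j + 1)) = ⊥ := by
  rw [eq_bot_iff]
  intro x hx
  have h : x ∈ ⨆ n : ℕ, X.weightSpace (μ + n) := by
    rw [hX.iSup_weightSpace]
    trivial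
  have := mem_iSup_of_mem_eigenspace (f := X.L 0) (fun _ => le_rfl) h hx
  rw [Submodule.mem_iSup] at this
  refine this ⊥ fun n => iSup_le fun hn => ?_
  exfalso
  have h2 : ((n + (j + 1) : ℕ) : ℂ) = 0 := by push_cast; linear_combination hn
  exact absurd (Nat.cast_eq_zero.1 h2) (by omega)

theorem IsGeneratedByHighestWeight.weightSpace_ne_bot [Nontrivial N] {μ : ℂ}
    (hX : X.IsGeneratedByHighestWeight μ) : X.weightSpace μ ≠ ⊥ := by
  intro h
  apply top_ne_bot (α := Submodule ℂ N)
  rw [← hX, eq_bot_iff]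
  refine sInf_le ⟨fun x hx => ?_, by simp⟩
  have : x ∈ X.weightSpace μ := Module.End.mem_eigenspace_iff.2 hx.1
  rwa [h] at this

end WeakModule

end VertexOperatorAlgebra


/-! ### Traces of zero modes of Virasoro descendants -/

namespace VertexOperatorAlgebra

variable {V : Type*} [AddCommGroup V] [Module ℂ V]

namespace WeakModule

variable {A : VertexOperatorAlgebra V} {N : Type*} [AddCommGroup N] [Module ℂ N]
  (X : A.WeakModule N)

/-- The trace of `v_(n)`, compressed to the homogeneous part of degree `μ`, as a function of
`v`. -/
def modeTrace (μ : ℂ) (n : ℤ) : V →ₗ[ℂ] ℂ where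
  toFun v := subTrace (X.weightSpace μ) (X.mode v n)
  map_add' u v := by rw [mode_add, map_add]
  map_smul' a v := by rw [mode_smul, map_smul]; rfl

theorem modeTrace_apply (μ : ℂ) (n : ℤ) (v : V) :
    X.modeTrace μ n v = subTrace (X.weightSpace μ) (X.mode v n) := rfl

theorem trace_zeroMode {n : ℕ} (v : A.weightSpace n) (μ : ℂ) :
    LinearMap.trace ℂ (X.weightSpace μ) (X.zeroMode v μ) = X.modeTrace μ (n - 1) v :=
  (subTrace_eq_trace_restrict fun _ hx => X.mode_mem_weightSpace v.2 hx).symm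

variable {X}

theorem IsGradedBy.finiteDimensional {h : ℂ} (hX : X.IsGradedBy h) (k : ℤ) :
    FiniteDimensional ℂ (X.weightSpace (h + k)) :=
  hX.finite_weightSpace k

section Recursion

variable {h : ℂ} {d : ℤ} {v : V}

/-- The commutator of `ω_(1-j)` and `v_(d-1+j)` is a combination of the zero modes of `ω_(i) v =
L_{i-1} v`. For `i = 0` this is `o(L_{-1} v) = -d o(v)`, traceless by `hv`; for `i ≥ 1` the
hypothesis `hL` applies. -/
theorem subTrace_mode_comm_of_forall {μ : ℂ} (hv : X.modeTrace μ (d - 1) v = 0)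
    (hL : ∀ i : ℕ, 1 ≤ i → X.modeTrace μ (d - i) (A.mode A.ω i v) = 0) (j : ℤ) :
    subTrace (X.weightSpace μ) (X.mode A.ω (1 - j) * X.mode v (d - 1 + j)) =
      subTrace (X.weightSpace μ) (X.mode v (d - 1 + j) * X.mode A.ω (1 - j)) := by
  obtain ⟨b, hb⟩ := exists_ncoeff_eq_zero (A.Y A.ω) v
  have hb' : ∀ i : ℕ, b ≤ i → A.mode A.ω i v = 0 := fun i hi => hb i hi
  have hsum : ∀ x ∈ X.weightSpace μ,
      (X.mode A.ω (1 - j) * X.mode v (d - 1 + j) - X.mode v (d - 1 + j) * X.mode A.ω (1 - j)) x =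
        (∑ i ∈ Finset.range b.toNat, (Ring.choose (1 - j) i : ℤ) •
          X.mode (A.mode A.ω i v) (d - i)) x := by
    intro x _
    refine (X.commutator A.ω v x (1 - j) (d - 1 + j)).trans ?_
    rw [finsum_eq_sum_of_support_subset (s := Finset.range b.toNat), LinearMap.sum_apply]
    · refine Finset.sum_congr rfl fun i _ => ?_
      rw [show 1 - j + (d - 1 + j) - (i : ℤ) = d - i by ring]
      rfl
    · intro i hi
      by_contra hi'
      simp only [Finset.coe_range, Set.mem_Iio, not_lt] at hi'
      apply hi
      simp only
      rw [hb' i (by omega), mode_zero]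
      simp
  rw [← sub_eq_zero, ← map_sub, subTrace_congr hsum, map_sum]
  refine Finset.sum_eq_zero fun i _ => ?_
  rw [map_zsmul, ← modeTrace_apply]
  rcases Nat.eq_zero_or_pos i with rfl | hi
  · rw [modeTrace_apply, Nat.cast_zero, mode_derivative, map_smul, sub_zero, ← modeTrace_apply, hv]
    simp
  · rw [hL i hi, smul_zero]

variable (hX : X.IsGradedBy h) (hvd : v ∈ A.weightSpace d)
  (hv : ∀ k : ℤ, k ≤ 0 → X.modeTrace (h + k) (d - 1) v = 0)
  (hL : ∀ k : ℤ, k ≤ 0 → ∀ i : ℕ, 1 ≤ i → X.modeTrace (h + k) (d - i) (A.mode A.ω i v) = 0)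

include hX hvd hv hL

/-- Exchanging the factors inside one degree and then using cyclicity, which moves the trace from
degree `l` to `l + j`, shows that the trace is unchanged when the degree drops by `|j|`. Below the
bound of the grading it is zero. -/
theorem IsGradedBy.subTrace_L_mode_eq_zero {j : ℤ} (hj : j ≠ 0) {k : ℤ} (hk : k ≤ 0) :
    subTrace (X.weightSpace (h + k)) (X.mode A.ω (1 - j) * X.mode v (d - 1 + j)) = 0 := by
  have cyc : ∀ l : ℤ,
      subTrace (X.weightSpace (h + l)) (X.mode v (d - 1 + j) * X.mode A.ω (1 - j)) =
        subTrace (X.weightSpace (h + (l + j : ℤ)))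
          (X.mode A.ω (1 - j) * X.mode v (d - 1 + j)) := by
    intro l
    have := hX.finiteDimensional l
    have := hX.finiteDimensional (l + j)
    exact subTrace_mul_comm
      (fun x hx => X.mode_mem A.ω_mem_weightSpace _ hx (by push_cast; ring))
      (fun x hx => X.mode_mem hvd _ hx (by push_cast; ring))
  have step : ∀ l : ℤ, l ≤ 0 →
      subTrace (X.weightSpace (h + l)) (X.mode A.ω (1 - j) * X.mode v (d - 1 + j)) =
        subTrace (X.weightSpace (h + (l - |j| : ℤ)))
          (X.mode A.ω (1 - j) * X.mode v (d - 1 + j)) := by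
    intro l hl
    rcases lt_or_gt_of_ne hj with hj' | hj'
    · rw [subTrace_mode_comm_of_forall (hv l hl) (hL l hl), cyc, abs_of_neg hj', sub_neg_eq_add]
    -- For `j > 0` cyclicity raises the degree, so it is applied at `l - j` and read backwards; the
    -- factors are thus exchanged only in degrees at most `h`.
    · have hl' : l - j ≤ 0 := by omega
      rw [abs_of_pos hj', subTrace_mode_comm_of_forall (hv _ hl') (hL _ hl'), cyc,
        sub_add_cancel]
  obtain ⟨n₀, hn₀⟩ := hX.bounded
  have down : ∀ (m : ℕ) (l : ℤ), l ≤ 0 → l < n₀ + m →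
      subTrace (X.weightSpace (h + l)) (X.mode A.ω (1 - j) * X.mode v (d - 1 + j)) = 0 := by
    intro m
    induction m with
    | zero =>
      intro l _ hl
      apply subTrace_eq_zero_of_eq_zero
      rw [hn₀ l (by simpa using hl)]
      simp
    | succ m ih =>
      intro l hl hlm
      have := abs_pos.2 hj
      rw [step l hl]
      exact ih _ (by omega) (by push_cast at hlm; omega)
  exact down (k - n₀ + 1).toNat k hk (by omega)

/-- The recursion for traces of zero modes of Virasoro descendants. -/
theorem IsGradedBy.modeTrace_L_neg_eq_zero {m : ℕ} (hm : 1 ≤ m) {k : ℤ} (hk : k ≤ 0) :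
    X.modeTrace (h + k) (d + m - 1) (A.L (-m) v) = 0 := by
  have hfirst : ∀ i : ℕ, subTrace (X.weightSpace (h + k))
      (X.mode A.ω (-m + 1 - i) * X.mode v (d + m - 1 + i)) = 0 := by
    intro i
    have := hX.subTrace_L_mode_eq_zero hvd hv hL (j := m + i) (by omega) hk
    rw [show -(m : ℤ) + 1 - i = 1 - (m + i) by ring,
      show d + m - 1 + (i : ℤ) = d - 1 + (m + i) by ring, this]
  have hsecond : ∀ i : ℕ, subTrace (X.weightSpace (h + k))
      (X.mode v (d + m - 1 + (-m + 1) - i) * X.mode A.ω i) = 0 := by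
    intro i
    rw [show d + m - 1 + (-m + 1) - (i : ℤ) = d - 1 + (1 - i) by ring]
    -- Here `ω_(1) = L_0` is the scalar `h + k`, leaving a multiple of `tr o(v)`. This is the case
    -- `j = 0`, which the descent in degree cannot reach.
    by_cases hi : i = 1
    · subst hi
      rw [subTrace_congr (g := (h + k) • X.mode v (d - 1)), map_smul, ← modeTrace_apply, hv k hk,
        smul_zero]
      intro x hx
      have hx' := X.mem_weightSpace_iff.1 hx
      simp [hx']
    · have := hX.subTrace_L_mode_eq_zero hvd hv hL (j := 1 - i) (by omega) hk
      rw [subTrace_mode_comm_of_forall (hv k hk) (hL k hk)] at this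
      rwa [show 1 - (1 - (i : ℤ)) = i by ring] at this
  -- Bounds valid on the whole homogeneous part, so that one finite sum of operators represents the
  -- mode and the trace can be taken termwise.
  obtain ⟨q₁, hq₁⟩ := hX.exists_mode_eq_zero hvd k
  obtain ⟨q₂, hq₂⟩ := hX.exists_mode_eq_zero (d := 2) A.ω_mem_weightSpace k
  have hsum : ∀ x ∈ X.weightSpace (h + k), X.mode (A.L (-m) v) (d + m - 1) x =
      (∑ i ∈ Finset.range (max (q₁ - (d + m - 1)).toNat q₂.toNat),
        ((-1) ^ i * Ring.choose (-m + 1 : ℤ) i : ℤ) •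
          (X.mode A.ω (-m + 1 - i) * X.mode v (d + m - 1 + i) -
            ((-m + 1 : ℤ).negOnePow : ℤ) •
              (X.mode v (d + m - 1 + (-m + 1) - i) * X.mode A.ω i))) x := by
    intro x hx
    refine (X.borcherds.assoc A.ω v x (d + m - 1) (-m + 1)).trans ?_
    rw [finsum_eq_sum_of_support_subset, LinearMap.sum_apply]
    · rfl
    · intro i hi
      by_contra hi'
      simp only [Finset.coe_range, Set.mem_Iio, not_lt, max_le_iff] at hi'
      apply hi
      have h1 := hq₁ (d + m - 1 + i) (by omega) x hx
      have h2 := hq₂ i (by omega) x hx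
      simp only [mode] at h1 h2
      simp only
      rw [h1, h2]
      simp
  rw [modeTrace_apply, subTrace_congr hsum, map_sum]
  refine Finset.sum_eq_zero fun i _ => ?_
  rw [map_zsmul, map_sub, map_zsmul, hfirst, hsecond]
  simp

end Recursion

end WeakModule

/-- The vector `L_{n_1} ⋯ L_{n_r} x`. -/
def virWord (A : VertexOperatorAlgebra V) (w : List ℤ) (x : V) : V :=
  w.foldr (fun n y => A.L n y) x

variable {A : VertexOperatorAlgebra V}

theorem virWord_cons (n : ℤ) (w : List ℤ) (x : V) :
    A.virWord (n :: w) x = A.L n (A.virWord w x) := rfl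

theorem mem_weightSpace_of_isHighestWeightVector {s : ℂ} {x : V}
    (hx : IsHighestWeightVector A.L s x) : x ∈ A.weightSpace s :=
  Module.End.mem_eigenspace_iff.2 hx.1

theorem virWord_mem_weightSpace {s : ℤ} {x : V} (hx : x ∈ A.weightSpace s) (w : List ℤ) :
    A.virWord w x ∈ A.weightSpace ((s - w.sum : ℤ) : ℂ) := by
  induction w with
  | nil => simpa [virWord] using hx
  | cons n w ih =>
    exact A.adjoint.L_mem n ih (by rw [List.sum_cons]; push_cast; ring)

/-- The span of all `L_{n_1} ⋯ L_{n_r} x` with `r ≤ l` and `n_1 + ⋯ + n_r = d`. -/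
def virWordSpan (A : VertexOperatorAlgebra V) (x : V) (l : ℕ) (d : ℤ) : Submodule ℂ V :=
  Submodule.span ℂ {y | ∃ w : List ℤ, w.length ≤ l ∧ w.sum = d ∧ A.virWord w x = y}

theorem virWord_mem_virWordSpan {w : List ℤ} {x : V} {l : ℕ} {d : ℤ} (hl : w.length ≤ l)
    (hd : w.sum = d) : A.virWord w x ∈ A.virWordSpan x l d :=
  Submodule.subset_span ⟨w, hl, hd, rfl⟩

theorem L_mem_virWordSpan {x y : V} {l : ℕ} {d : ℤ} (hy : y ∈ A.virWordSpan x l d) (n : ℤ) :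
    A.L n y ∈ A.virWordSpan x (l + 1) (n + d) := by
  have : A.virWordSpan x l d ≤ (A.virWordSpan x (l + 1) (n + d)).comap (A.L n) := by
    refine Submodule.span_le.2 ?_
    rintro _ ⟨w, hl, hd, rfl⟩
    exact virWord_mem_virWordSpan (w := n :: w) (by simpa using hl) (by simp [hd])
  exact this hy

/-- A nonnegative mode can be commuted through the word to the highest weight vector, where it acts
as a scalar or zero. No correction is longer than the original word, which makes induction on the
length possible. -/
theorem L_nonneg_virWord_mem {s : ℂ} {x : V} (hx : IsHighestWeightVector A.L s x) (w : List ℤ) :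
    ∀ m : ℤ, 0 ≤ m → A.L m (A.virWord w x) ∈ A.virWordSpan x w.length (m + w.sum) := by
  induction w with
  | nil =>
    intro m hm
    change A.L m x ∈ _
    rcases hm.eq_or_lt with rfl | hm
    · rw [hx.1]
      exact Submodule.smul_mem _ _ (virWord_mem_virWordSpan (w := []) le_rfl (by simp))
    · rw [hx.2 m hm]
      exact Submodule.zero_mem _
  | cons n w ih =>
    intro m hm
    rw [virWord_cons, L_comm]
    refine Submodule.add_mem _ (Submodule.add_mem _ ?_ (Submodule.smul_mem _ _ ?_)) ?_
    · rw [List.sum_cons, show m + (n + w.sum) = n + (m + w.sum) by ring]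
      exact L_mem_virWordSpan (ih m hm) n
    · exact virWord_mem_virWordSpan (w := (m + n) :: w) (by simp) (by simp [add_assoc])
    · split_ifs with hmn
      · refine Submodule.smul_mem _ _ (virWord_mem_virWordSpan (by simp) ?_)
        rw [List.sum_cons, ← add_assoc, hmn, zero_add]
      · rw [zero_smul]
        exact Submodule.zero_mem _

/-- If the zero mode of a highest weight vector has trace zero on all homogeneous parts `N_{h+k}`,
`k ≤ 0`, then so have the zero modes of its descendants. -/
theorem WeakModule.IsGradedBy.modeTrace_virWord_eq_zero {N : Type*} [AddCommGroup N] [Module ℂ N]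
    {X : A.WeakModule N} {h : ℂ} (hX : X.IsGradedBy h) {s : ℤ} {x : V}
    (hx : IsHighestWeightVector A.L s x)
    (htr : ∀ k : ℤ, k ≤ 0 → X.modeTrace (h + k) (s - 1) x = 0) (l : ℕ) :
    ∀ w : List ℤ, w.length ≤ l → ∀ k : ℤ, k ≤ 0 →
      X.modeTrace (h + k) (s - w.sum - 1) (A.virWord w x) = 0 := by
  induction l with
  | zero =>
    intro w hw k hk
    obtain rfl : w = [] := List.length_eq_zero_iff.1 (by omega)
    simpa [virWord] using htr k hk
  | succ l ih =>
    have hspan : ∀ (d k : ℤ), k ≤ 0 → ∀ y ∈ A.virWordSpan x l d,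
        X.modeTrace (h + k) (s - d - 1) y = 0 := by
      intro d k hk y hy
      have : A.virWordSpan x l d ≤ LinearMap.ker (X.modeTrace (h + k) (s - d - 1)) := by
        refine Submodule.span_le.2 ?_
        rintro _ ⟨w, hl, rfl, rfl⟩
        exact ih w hl k hk
      exact this hy
    intro w hw k hk
    cases w with
    | nil => exact ih [] (by simp) k hk
    | cons n w =>
      have hwl : w.length ≤ l := by simpa using hw
      -- Applying a nonnegative mode to the tail yields words of length at most `l`, so the
      -- induction hypothesis covers it. This is the input `hL` of the recursion, and it also
      -- settles a nonnegative first letter.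
      have hnonneg : ∀ m : ℤ, 0 ≤ m → ∀ k : ℤ, k ≤ 0 →
          X.modeTrace (h + k) (s - (m + w.sum) - 1) (A.L m (A.virWord w x)) = 0 := by
        intro m hm k hk
        refine hspan _ k hk _ ?_
        refine Submodule.span_mono ?_ (L_nonneg_virWord_mem hx w m hm)
        rintro _ ⟨w', hl, hd, rfl⟩
        exact ⟨w', hl.trans hwl, hd, rfl⟩
      rw [virWord_cons, List.sum_cons]
      rcases le_or_gt 0 n with hn | hn
      · exact hnonneg n hn k hk
      · obtain ⟨m, rfl⟩ : ∃ m : ℕ, n = -m := ⟨n.natAbs, by omega⟩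
        have := hX.modeTrace_L_neg_eq_zero (m := m)
          (virWord_mem_weightSpace (mem_weightSpace_of_isHighestWeightVector hx) w)
          (fun k hk => ih w hwl k hk) (fun k hk i hi => ?_) (by omega) hk
        · rwa [show (s - w.sum + m - 1 : ℤ) = s - (-m + w.sum) - 1 by ring] at this
        · have h1 := hnonneg (i - 1) (by omega) k hk
          rw [VertexOperatorAlgebra.L, sub_add_cancel] at h1
          rwa [show s - w.sum - (i : ℤ) = s - (i - 1 + w.sum) - 1 by ring]

namespace HighestWeightDecomposition

theorem sub_proj_mem (D : A.HighestWeightDecomposition) (x : V) :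
    x - D.proj x ∈ ⨆ i : {i // D.wt i ≠ 0}, D.M i := by
  classical
  have hx : x ∈ ⨆ i, D.M i := by
    rw [D.isInternal.submodule_iSup_eq_top]
    trivial
  induction hx using Submodule.iSup_induction' with
  | mem i y hy =>
    rw [D.proj_apply hy]
    split_ifs with hi
    · simp
    · rw [sub_zero]
      exact Submodule.mem_iSup_of_mem (⟨i, hi⟩ : {i // D.wt i ≠ 0}) hy
  | zero => simp
  | add y z _ _ hy hz =>
    rw [map_add, add_sub_add_comm]
    exact Submodule.add_mem _ hy hz

/-- Only words in nonpositive modes are needed. Their letters never lower the degree, so a vector of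
degree at most `t` involves only generators of weight at most `t`. -/
theorem virSpan_le_iSup_virWord {s : ℂ} {x : V} (hx : IsHighestWeightVector A.L s x) :
    virSpan A.L {x} ≤ ⨆ w : {w : List ℤ // ∀ n ∈ w, n ≤ 0}, ℂ ∙ A.virWord w x := by
  refine virSpan_le A.adjoint.exists_L_comm ?_ ?_ ?_
  · rintro _ rfl
    exact hx.2
  · rintro _ rfl
    exact Submodule.mem_iSup_of_mem ⟨[], by simp⟩ (Submodule.mem_span_singleton_self _)
  · intro n hn y hy
    have : (⨆ w : {w : List ℤ // ∀ n ∈ w, n ≤ 0}, ℂ ∙ A.virWord w x) ≤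
        (⨆ w : {w : List ℤ // ∀ n ∈ w, n ≤ 0}, ℂ ∙ A.virWord w x).comap (A.L n) := by
      refine iSup_le fun w => (Submodule.span_singleton_le_iff_mem _ _).2 ?_
      refine Submodule.mem_iSup_of_mem ⟨n :: w.1, ?_⟩ (Submodule.mem_span_singleton_self _)
      intro m hm
      rcases List.mem_cons.1 hm with rfl | hm
      · exact hn
      · exact w.2 m hm
    exact this hy

/-- To be a conformal design can be checked on highest weight vectors of positive weight, if all
lower homogeneous parts are considered, too. -/
theorem isConformalDesign_of_highestWeight (D : A.HighestWeightDecomposition) {N : Type*}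
    [AddCommGroup N] [Module ℂ N] {X : A.WeakModule N} {h : ℂ} (hX : X.IsGradedBy h) {t : ℕ}
    (htr : ∀ s : ℕ, 0 < s → s ≤ t → ∀ x, IsHighestWeightVector A.L s x →
      ∀ k : ℤ, k ≤ 0 → X.modeTrace (h + k) (s - 1) x = 0) {k : ℤ} (hk : k ≤ 0) :
    D.IsConformalDesign X t (h + k) := by
  intro n hn v
  rw [X.trace_zeroMode, X.trace_zeroMode, ← sub_eq_zero, ← map_sub]
  choose gen _ hgen hM using D.exists_generator
  let P : {i // D.wt i ≠ 0} × {w : List ℤ // ∀ n ∈ w, n ≤ 0} → Submodule ℂ V :=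
    fun b => ℂ ∙ A.virWord b.2 (gen b.1)
  have hmem : (v : V) - D.proj v ∈ ⨆ b, P b := by
    refine (iSup_le fun i => ?_ : ⨆ i : {i // D.wt i ≠ 0}, D.M i ≤ ⨆ b, P b) (D.sub_proj_mem v)
    rw [hM]
    exact (virSpan_le_iSup_virWord (hgen i)).trans
      (iSup_le fun w => le_iSup P (i, w))
  have hev : ∀ b, P b ≤ (A.L 0).eigenspace (((D.wt b.1 : ℤ) - b.2.1.sum : ℤ) : ℂ) := fun b =>
    (Submodule.span_singleton_le_iff_mem _ _).2
      (virWord_mem_weightSpace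
        (by simpa using mem_weightSpace_of_isHighestWeightVector (hgen b.1)) _)
  have hvn : (v : V) - D.proj v ∈ (A.L 0).eigenspace (n : ℂ) :=
    Submodule.sub_mem _ v.2 (D.proj_mem_weightSpace v.2)
  have hle : ⨆ (b) (_ : (((D.wt b.1.1 : ℤ) - b.2.1.sum : ℤ) : ℂ) = n), P b ≤
      LinearMap.ker (X.modeTrace (h + k) (n - 1)) := by
    refine iSup₂_le fun b hb => (Submodule.span_singleton_le_iff_mem _ _).2 ?_
    have hb' : (D.wt b.1.1 : ℤ) - b.2.1.sum = n := by exact_mod_cast hb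
    -- This gives `D.wt b.1 ≤ n ≤ t`, so the hypothesis `htr` is available for the generator.
    have hsum : b.2.1.sum ≤ 0 := by simpa using List.sum_le_card_nsmul _ 0 b.2.2
    rw [LinearMap.mem_ker, ← hb']
    exact hX.modeTrace_virWord_eq_zero (by simpa using hgen b.1)
      (fun k hk => htr (D.wt b.1) (Nat.pos_of_ne_zero b.1.2) (by omega) _ (hgen b.1) k hk) _ _
      le_rfl k hk
  exact hle (mem_iSup_of_mem_eigenspace hev hmem hvn)

end HighestWeightDecomposition

end VertexOperatorAlgebra


/-! ### The test vectors `w ⊗ u`: projection and zero modes -/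

namespace VertexOperatorAlgebra

variable {V : Type*} [AddCommGroup V] [Module ℂ V] {A : VertexOperatorAlgebra V}

theorem WeakModule.mode_comm_of_mem_commutant {N : Type*} [AddCommGroup N] [Module ℂ N]
    (X : A.WeakModule N) {s : Set V} {u w : V} (hu : u ∈ s) (hw : w ∈ A.commutant s) (m n : ℤ)
    (x : N) : X.mode u m (X.mode w n x) = X.mode w n (X.mode u m x) := by
  rw [← sub_eq_zero, X.commutator]
  refine finsum_eq_zero_of_forall_eq_zero fun i => ?_
  rw [hw u hu i (by omega), X.mode_zero]
  simp

theorem HighestWeightDecomposition.proj_proj (D : A.HighestWeightDecomposition) (x : V) :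
    D.proj (D.proj x) = D.proj x := by
  classical
  have hx : x ∈ ⨆ i, D.M i := by
    rw [D.isInternal.submodule_iSup_eq_top]
    trivial
  induction hx using Submodule.iSup_induction' with
  | mem i y hy =>
    rw [D.proj_apply hy]
    split_ifs with hi
    · rw [D.proj_apply hy, if_pos hi]
    · simp
  | zero => simp
  | add y z _ _ hy hz => simp only [map_add, hy, hz]

/-- The vector `L_{-2}^a 1`. -/
def omegaPow (A : VertexOperatorAlgebra V) : ℕ → V
  | 0 => A.one
  | a + 1 => A.mode A.ω (-1) (A.omegaPow a)

theorem omegaPow_mem_weightSpace (A : VertexOperatorAlgebra V) (a : ℕ) :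
    A.omegaPow a ∈ A.weightSpace ((2 * a : ℤ) : ℂ) := by
  induction a with
  | zero => simpa [omegaPow] using A.one_mem_weightSpace
  | succ a ih =>
    exact A.adjoint.mode_mem A.ω_mem_weightSpace (-1) ih (by push_cast; ring)

/-- The polynomial `x (x + 2) ⋯ (x + 2 (a - 1))`. -/
def omegaPoly (a : ℕ) : Polynomial ℂ :=
  ∏ b ∈ Finset.range a, (Polynomial.X + Polynomial.C (2 * b : ℂ))

theorem monic_omegaPoly (a : ℕ) : (omegaPoly a).Monic :=
  Polynomial.monic_prod_of_monic _ _ fun _ _ => Polynomial.monic_X_add_C _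

theorem natDegree_omegaPoly (a : ℕ) : (omegaPoly a).natDegree = a := by
  rw [omegaPoly, Polynomial.natDegree_prod_of_monic _ _ fun _ _ => Polynomial.monic_X_add_C _]
  simp only [Polynomial.natDegree_X_add_C, Finset.sum_const, Finset.card_range, smul_eq_mul, mul_one]

/-- Each further factor `L_{-2}`, applied to a vector of degree `2a`, multiplies the zero mode on
the lowest part by `μ + 2a`. -/
theorem WeakModule.mode_omegaPow_of_lowest {N : Type*} [AddCommGroup N] [Module ℂ N]
    (X : A.WeakModule N) {μ : ℂ} (hμ : ∀ j : ℕ, X.weightSpace (μ - (j + 1)) = ⊥) (a : ℕ) {x : N}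
    (hx : x ∈ X.weightSpace μ) :
    X.mode (A.omegaPow a) (2 * a - 1) x = (omegaPoly a).eval μ • x := by
  induction a with
  | zero => simp [omegaPow, omegaPoly, mode_vacuum]
  | succ a ih =>
    have h := X.mode_L_neg_two_of_lowest hμ (A.omegaPow_mem_weightSpace a) hx
    rw [ih] at h
    rw [show 2 * ((a + 1 : ℕ) : ℤ) - 1 = 2 * a + 1 by push_cast; ring, omegaPow, h, smul_smul,
      omegaPoly, omegaPoly, Finset.prod_range_succ, Polynomial.eval_mul]
    congr 1
    simp
    ring

namespace IsVirasoroSplitting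

variable {ω' : V} {c' : ℂ} (hω' : A.IsVirasoroSplitting ω' c')

theorem coe_mode_virasoroVOA (u v : A.generated {ω'}) (n : ℤ) :
    (hω'.virasoroVOA.mode u n v : V) = A.mode u n v :=
  A.coe_ncoeff_restrictY (A.isSubalgebra_generated _) u v n

theorem coe_mode_commutantVOA (u v : A.commutant (A.generated {ω'})) (n : ℤ) :
    (hω'.commutantVOA.mode u n v : V) = A.mode u n v :=
  A.coe_ncoeff_restrictY (A.isSubalgebra_commutant _) u v n

include hω' in
theorem mode_eq_of_mem_generated {u : V} (hu : u ∈ A.generated {ω'}) {n : ℤ} (hn : 0 ≤ n) :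
    A.mode ω' n u = A.mode A.ω n u := by
  have h1 : A.ω - ω' ∈ A.commutant {u} := fun y hy =>
    hω'.sub_mem_commutant y (Set.mem_singleton_iff.1 hy ▸ hu)
  have h2 := A.mem_commutant_comm.1 h1 _ rfl n hn
  rw [mode_sub, sub_eq_zero] at h2
  exact h2.symm

theorem mode_eq_of_mem_commutant {w : V} (hw : w ∈ A.commutant (A.generated {ω'})) {n : ℤ}
    (hn : 0 ≤ n) : A.mode (A.ω - ω') n w = A.mode A.ω n w := by
  rw [mode_sub, hw ω' (A.subset_generated _ rfl) n hn, sub_zero]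

theorem coe_mem_weightSpace_of_virasoroVOA {μ : ℂ} {u : A.generated {ω'}}
    (hu : u ∈ hω'.virasoroVOA.weightSpace μ) : (u : V) ∈ A.weightSpace μ := by
  have h := congrArg Subtype.val (hω'.virasoroVOA.mem_weightSpace_iff.1 hu)
  rw [coe_mode_virasoroVOA] at h
  rw [A.mem_weightSpace_iff, ← hω'.mode_eq_of_mem_generated u.2 zero_le_one]
  exact h

theorem coe_mem_weightSpace_of_commutantVOA {μ : ℂ} {w : A.commutant (A.generated {ω'})}
    (hw : w ∈ hω'.commutantVOA.weightSpace μ) : (w : V) ∈ A.weightSpace μ := by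
  have h := congrArg Subtype.val (hω'.commutantVOA.mem_weightSpace_iff.1 hw)
  rw [coe_mode_commutantVOA] at h
  rw [A.mem_weightSpace_iff, ← mode_eq_of_mem_commutant w.2 zero_le_one]
  exact h

/-- A natural projection `π` annihilates `w ⊗ V_{ω'}` for each highest weight vector `w` of positive
weight in the commutant of `V_{ω'}`. -/
theorem proj_mode_eq_zero {D : A.HighestWeightDecomposition} (hD : D.IsNatural) {s : ℕ}
    (hs : 0 < s) {w : A.commutant (A.generated {ω'})}
    (hw : IsHighestWeightVector hω'.commutantVOA.L s w) (d : ℕ) :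
    ∀ u ∈ A.generated {ω'}, u ∈ A.weightSpace d → D.proj (A.mode w (-1) u) = 0 := by
  induction d using Nat.strong_induction_on with
  | _ d ih =>
    intro u hu hud
    have hgen : ω' ∈ A.generated {ω'} := A.subset_generated _ rfl
    have hwA := hω'.coe_mem_weightSpace_of_commutantVOA
      (mem_weightSpace_of_isHighestWeightVector hw)
    have hx : A.mode w (-1) u ∈ A.weightSpace ((s + d : ℕ) : ℂ) :=
      A.adjoint.mode_mem hwA (-1) hud (by push_cast; ring)
    have hcomm : ∀ {v : V}, v ∈ A.generated {ω'} → ∀ {y : V},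
        y ∈ A.commutant (A.generated {ω'}) → ∀ m n x,
        A.mode v m (A.mode y n x) = A.mode y n (A.mode v m x) := fun hv _ hy m n x =>
      A.adjoint.mode_comm_of_mem_commutant hv hy m n x
    -- Since `π` is idempotent, it suffices that `π(w ⊗ u)` is itself a highest weight vector of
    -- positive weight. It is, because for `n > 0` the vector `L_n (w ⊗ u) = w ⊗ L'_n u` has lower
    -- degree and is annihilated by `π` by induction, while `π` commutes with `L_n`.
    rw [← D.proj_proj]
    refine hD (s + d) _ (by omega) ⟨?_, fun n hn => ?_⟩
    · exact Module.End.mem_eigenspace_iff.1 (D.proj_mem_weightSpace hx)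
    · have h1 : A.mode (A.ω - ω') (n + 1) (A.mode w (-1) u) = 0 := by
        -- Both sides are the commuting modes `w_(-1)` and `u_(-1)` applied to the vacuum.
        have e : A.mode w (-1) u = A.mode u (-1) w := by
          conv_lhs => rw [← A.mode_neg_one_one u]
          rw [← hcomm hu w.2, A.mode_neg_one_one]
        have h2 : A.mode (A.ω - ω') (n + 1) w = 0 := by
          have := congrArg Subtype.val (hw.2 n hn)
          rwa [VertexOperatorAlgebra.L, coe_mode_commutantVOA] at this
        rw [e, ← hcomm hu hω'.sub_mem_commutant, h2, map_zero]
      have h3 : A.L n (A.mode w (-1) u) = A.mode w (-1) (A.mode ω' (n + 1) u) := by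
        rw [mode_sub, sub_eq_zero] at h1
        rw [VertexOperatorAlgebra.L, h1, hcomm hgen w.2]
      rw [← D.proj_L, h3]
      have h4 : A.mode ω' (n + 1) u ∈ A.weightSpace (d - n) := by
        rw [hω'.mode_eq_of_mem_generated hu (by omega)]
        exact A.adjoint.L_mem n hud rfl
      have h5 : A.mode ω' (n + 1) u ∈ A.generated {ω'} :=
        (A.isSubalgebra_generated {ω'}).mode_mem ω' hgen u hu (n + 1)
      rcases le_or_gt n d with hnd | hnd
      · refine ih (d - n).toNat (by omega) _ h5 ?_
        have : (((d - n).toNat : ℤ) : ℂ) = d - n := by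
          rw [Int.toNat_of_nonneg (by omega)]
          push_cast
          rfl
        rw [Int.cast_natCast] at this
        rwa [this]
      · rw [A.weightSpace_eq_bot, Submodule.mem_bot] at h4
        · rw [h4, map_zero, map_zero]
        · intro m hm
          have : (m : ℤ) = d - n := by exact_mod_cast hm
          omega

include hω' in
/-- The trace of the zero mode of `w ⊗ u` on a homogeneous part of a module is the trace of the
product of the zero modes. -/
theorem modeTrace_mode_neg_one {N : Type*} [AddCommGroup N] [Module ℂ N] {X : A.WeakModule N}
    {h : ℂ} (hX : X.IsGradedBy h) (k : ℤ) {d : ℤ} {s : ℕ} (hs : 0 < s) {u w : V}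
    (hu : u ∈ A.generated {ω'}) (hud : u ∈ A.weightSpace d)
    (hw : w ∈ A.commutant (A.generated {ω'})) (hws : w ∈ A.weightSpace s) :
    X.modeTrace (h + k) (d + s - 1) (A.mode w (-1) u) =
      subTrace (X.weightSpace (h + k)) (X.mode u (d - 1) * X.mode w (s - 1)) := by
  have hfin := hX.finiteDimensional k
  have hgen : ω' ∈ A.generated {ω'} := A.subset_generated _ rfl
  have hZ : ∀ x ∈ X.weightSpace (h + k), X.mode ω' 1 x ∈ X.weightSpace (h + k) := fun x hx =>
    X.mode_mem hω'.mem_weightSpace 1 hx (by push_cast; ring)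
  have hZu : ∀ (q : ℤ) (x : N), X.mode ω' 1 (X.mode u q x) =
      X.mode u q (X.mode ω' 1 x) + ((d : ℂ) - q - 1) • X.mode u q x := fun q x =>
    X.mode_one_mode (hω'.mode_eq_of_mem_generated hu le_rfl)
      ((hω'.mode_eq_of_mem_generated hu zero_le_one).trans (A.mem_weightSpace_iff.1 hud)) q x
  have hZw : ∀ (q : ℤ) (x : N), X.mode ω' 1 (X.mode w q x) = X.mode w q (X.mode ω' 1 x) :=
    fun q x => X.mode_comm_of_mem_commutant hgen hw 1 q x
  -- These terms shift the eigenvalues of `ω'_(1)` by `-(s + i)`, which is nonzero because `s > 0`;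
  -- modes of `w` do not contribute to the shift.
  have hfirst : ∀ i : ℕ, subTrace (X.weightSpace (h + k))
      (X.mode w (-1 - i) * X.mode u (d + s - 1 + i)) = 0 := by
    intro i
    refine subTrace_eq_zero_of_commutator (e := (d : ℂ) - (d + s - 1 + i : ℤ) - 1) hZ
      (fun x hx => X.mode_mem hws _ (X.mode_mem hud _ hx rfl) (by push_cast; ring)) ?_
      fun x _ => ?_
    · intro h0
      have h1 : ((s + i : ℕ) : ℂ) = 0 := by
        push_cast at h0 ⊢
        linear_combination -h0
      exact absurd (Nat.cast_eq_zero.1 h1) (by omega)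
    · simp only [Module.End.mul_apply, hZw, hZu, map_add, map_smul]
  -- Here the shift is `i + 1 - s`, so `i = s - 1` alone survives.
  have hsecond : ∀ i : ℕ, i ≠ s - 1 → subTrace (X.weightSpace (h + k))
      (X.mode u (d + s - 1 - 1 - i) * X.mode w i) = 0 := by
    intro i hi
    refine subTrace_eq_zero_of_commutator (e := (d : ℂ) - (d + s - 1 - 1 - i : ℤ) - 1) hZ
      (fun x hx => X.mode_mem hud _ (X.mode_mem hws _ hx rfl) (by push_cast; ring)) ?_
      fun x _ => ?_
    · intro h0
      have h1 : ((i + 1 : ℕ) : ℂ) = (s : ℂ) := by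
        push_cast at h0 ⊢
        linear_combination h0
      have := Nat.cast_injective h1
      omega
    · simp only [Module.End.mul_apply, hZw, hZu]
  obtain ⟨q₁, hq₁⟩ := hX.exists_mode_eq_zero hud k
  obtain ⟨q₂, hq₂⟩ := hX.exists_mode_eq_zero (d := s) (by simpa using hws) k
  have hsum : ∀ x ∈ X.weightSpace (h + k), X.mode (A.mode w (-1) u) (d + s - 1) x =
      (∑ i ∈ Finset.range (max (max (q₁ - (d + s - 1)).toNat q₂.toNat) s),
        (X.mode w (-1 - i) * X.mode u (d + s - 1 + i) +
          X.mode u (d + s - 1 - 1 - i) * X.mode w i)) x := by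
    intro x hx
    rw [X.mode_neg_one_mode, finsum_eq_sum_of_support_subset, LinearMap.sum_apply]
    · rfl
    · intro i hi
      by_contra hi'
      simp only [Finset.coe_range, Set.mem_Iio, not_lt, max_le_iff] at hi'
      apply hi
      simp only
      rw [hq₁ (d + s - 1 + i) (by omega) x hx, hq₂ i (by omega) x hx]
      simp
  rw [X.modeTrace_apply, subTrace_congr hsum, map_sum, Finset.sum_eq_single (s - 1)]
  · rw [map_add, hfirst, zero_add, show d + s - 1 - 1 - ((s - 1 : ℕ) : ℤ) = d - 1 by omega,
      show ((s - 1 : ℕ) : ℤ) = s - 1 by omega]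
  · intro i _ hi
    rw [map_add, hfirst, hsecond i hi, add_zero]
  · intro hn
    exact absurd (Finset.mem_range.2 (lt_of_lt_of_le (by omega) (le_max_right _ _))) hn

end IsVirasoroSplitting

end VertexOperatorAlgebra


/-! ### Trace identities on the decomposed module -/

namespace VertexOperatorAlgebra

variable {V N : Type*} [AddCommGroup V] [Module ℂ V] [AddCommGroup N] [Module ℂ N]
  {A : VertexOperatorAlgebra V} {ω' : V} {c' : ℂ}

/-- A decomposition `N = ⨁_{h' ∈ S} M(h') ⊗ K(h - h')` of an `A`-module as a module for the tensor
product of a Virasoro subalgebra and its commutant. -/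
structure TensorDecomposition (hω' : A.IsVirasoroSplitting ω' c') (X : A.WeakModule N) (h : ℂ)
    {S : Finset ℂ} {M K : S → Type*}
    [∀ i, AddCommGroup (M i)] [∀ i, Module ℂ (M i)] [∀ i, AddCommGroup (K i)] [∀ i, Module ℂ (K i)]
    (XM : ∀ i, hω'.virasoroVOA.WeakModule (M i)) (XK : ∀ i, hω'.commutantVOA.WeakModule (K i))
    (φ : ∀ i, M i ⊗[ℂ] K i →ₗ[ℂ] N) : Prop where
  isGradedBy : X.IsGradedBy h
  isGeneratedByHighestWeight : ∀ i, (XM i).IsGeneratedByHighestWeight (i : ℂ)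
  isGradedBy_right : ∀ i, (XK i).IsGradedBy (h - (i : ℂ))
  injective : ∀ i, Function.Injective (φ i)
  iSupIndep_range : iSupIndep fun i => LinearMap.range (φ i)
  iSup_range : ⨆ i, LinearMap.range (φ i) = ⊤
  mode_left : ∀ (u : A.generated {ω'}) (n : ℤ) (i : S) (x : M i) (y : K i),
    X.mode (u : V) n (φ i (x ⊗ₜ y)) = φ i ((XM i).mode u n x ⊗ₜ y)
  mode_right : ∀ (w : A.commutant (A.generated {ω'})) (n : ℤ) (i : S) (x : M i) (y : K i),
    X.mode (w : V) n (φ i (x ⊗ₜ y)) = φ i (x ⊗ₜ (XK i).mode w n y)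

namespace TensorDecomposition

variable {hω' : A.IsVirasoroSplitting ω' c'} {X : A.WeakModule N} {h : ℂ} {S : Finset ℂ}
  {M K : S → Type*}
  [∀ i, AddCommGroup (M i)] [∀ i, Module ℂ (M i)] [∀ i, AddCommGroup (K i)] [∀ i, Module ℂ (K i)]
  {XM : ∀ i, hω'.virasoroVOA.WeakModule (M i)} {XK : ∀ i, hω'.commutantVOA.WeakModule (K i)}
  {φ : ∀ i, M i ⊗[ℂ] K i →ₗ[ℂ] N}
  (T : TensorDecomposition hω' X h XM XK φ)

include T

theorem mode_ω'_apply {i : S} {ν : ℂ} {x : M i} (hx : x ∈ (XM i).weightSpace ν) (y : K i) :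
    X.mode ω' 1 (φ i (x ⊗ₜ y)) = ν • φ i (x ⊗ₜ y) := by
  have hx' : (XM i).mode ⟨ω', A.subset_generated _ rfl⟩ 1 x = ν • x :=
    (XM i).mem_weightSpace_iff.1 hx
  rw [T.mode_left ⟨ω', A.subset_generated _ rfl⟩, hx', ← TensorProduct.smul_tmul', map_smul]

theorem tmul_mem_weightSpace {i : S} {ν κ : ℂ} {x : M i} (hx : x ∈ (XM i).weightSpace ν) {y : K i}
    (hy : y ∈ (XK i).weightSpace κ) : φ i (x ⊗ₜ y) ∈ X.weightSpace (ν + κ) := by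
  have hy' : (XK i).mode ⟨A.ω - ω', hω'.sub_mem_commutant⟩ 1 y = κ • y :=
    (XK i).mem_weightSpace_iff.1 hy
  have h2 := T.mode_right ⟨A.ω - ω', hω'.sub_mem_commutant⟩ 1 i x y
  rw [hy', TensorProduct.tmul_smul, map_smul] at h2
  rw [X.mem_weightSpace_iff, ← add_sub_cancel ω' A.ω, X.mode_add, LinearMap.add_apply,
    T.mode_ω'_apply hx, h2, add_smul]

omit T in
/-- The piece `M(h')_{h'+j} ⊗ K(h-h')_{h-h'+l}`. -/
def piece (XM : ∀ i, hω'.virasoroVOA.WeakModule (M i))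
    (XK : ∀ i, hω'.commutantVOA.WeakModule (K i)) (h : ℂ) (φ : ∀ i, M i ⊗[ℂ] K i →ₗ[ℂ] N)
    (i : S) (j : ℕ) (l : ℤ) : Submodule ℂ N :=
  tensorImage (φ i) ((XM i).weightSpace (i + j)) ((XK i).weightSpace (h - i + l))

theorem piece_le_weightSpace (i : S) (j : ℕ) (l : ℤ) :
    piece XM XK h φ i j l ≤ X.weightSpace (h + ((j + l : ℤ) : ℂ)) :=
  tensorImage_le fun x hx y hy => by
    have := T.tmul_mem_weightSpace hx hy
    rwa [show (i : ℂ) + j + (h - i + l) = h + ((j + l : ℤ) : ℂ) by push_cast; ring] at this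

theorem iSup_piece : ⨆ b : S × ℕ × ℤ, piece XM XK h φ b.1 b.2.1 b.2.2 = ⊤ := by
  set R := ⨆ b : S × ℕ × ℤ, piece XM XK h φ b.1 b.2.1 b.2.2
  rw [eq_top_iff, ← T.iSup_range]
  refine iSup_le fun i => ?_
  have h1 : ∀ (j : ℕ) (x : M i), x ∈ (XM i).weightSpace (i + j) → ∀ y, φ i (x ⊗ₜ y) ∈ R := by
    intro j x hx
    have : ⨆ l : ℤ, (XK i).weightSpace (h - i + l) ≤
        R.comap (φ i ∘ₗ TensorProduct.mk ℂ (M i) (K i) x) :=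
      iSup_le fun l y hy => Submodule.mem_iSup_of_mem (i, j, l) (tmul_mem_tensorImage hx hy)
    rw [(T.isGradedBy_right i).iSup_weightSpace] at this
    exact fun y => this Submodule.mem_top
  have h2 : ∀ (x : M i) (y : K i), φ i (x ⊗ₜ y) ∈ R := by
    intro x y
    have : ⨆ j : ℕ, (XM i).weightSpace (i + j) ≤
        R.comap (φ i ∘ₗ (TensorProduct.mk ℂ (M i) (K i)).flip y) :=
      iSup_le fun j x hx => h1 j x hx y
    rw [(T.isGeneratedByHighestWeight i).iSup_weightSpace] at this
    exact this (Submodule.mem_top (x := x))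
  rintro _ ⟨z, rfl⟩
  induction z using TensorProduct.induction_on with
  | zero => simp
  | tmul x y => exact h2 x y
  | add a b ha hb => rw [map_add]; exact R.add_mem ha hb

/-- The pieces span `N` and each lies in a single eigenspace of `L_0`, so a homogeneous part is the
sum of the pieces of its own degree. -/
theorem weightSpace_eq (k : ℤ) :
    X.weightSpace (h + k) = ⨆ (i) (j : ℕ), piece XM XK h φ i j (k - j) := by
  apply le_antisymm
  · intro x hx
    have hx' : x ∈ ⨆ b : S × ℕ × ℤ, piece XM XK h φ b.1 b.2.1 b.2.2 := by
      rw [T.iSup_piece]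
      trivial
    have hle := mem_iSup_of_mem_eigenspace
      (fun b : S × ℕ × ℤ => T.piece_le_weightSpace b.1 b.2.1 b.2.2) hx' hx
    refine (iSup₂_le fun b hb => ?_ : _ ≤ ⨆ (i) (j : ℕ), piece XM XK h φ i j (k - j)) hle
    have hb' : (b.2.1 + b.2.2 : ℤ) = k := by exact_mod_cast add_left_cancel hb
    rw [show b.2.2 = k - b.2.1 by omega]
    exact le_iSup₂ (f := fun i (j : ℕ) => piece XM XK h φ i j (k - j)) b.1 b.2.1
  · refine iSup₂_le fun i j => ?_
    have := T.piece_le_weightSpace i j (k - j)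
    rwa [add_sub_cancel] at this

theorem piece_le (i : S) (j : ℕ) (k : ℤ) : piece XM XK h φ i j (k - j) ≤ X.weightSpace (h + k) := by
  rw [T.weightSpace_eq]
  exact le_iSup₂ (f := fun i (j : ℕ) => piece XM XK h φ i j (k - j)) i j

theorem finiteDimensional_piece (i : S) (j : ℕ) (k : ℤ) :
    FiniteDimensional ℂ (piece XM XK h φ i j (k - j)) := by
  have := T.isGradedBy.finiteDimensional k
  exact Submodule.finiteDimensional_of_le (T.piece_le i j k)

theorem exists_weightSpace_right_eq_bot :
    ∃ n₀ : ℤ, ∀ (i : S) (n : ℤ), n < n₀ → (XK i).weightSpace (h - i + n) = ⊥ := by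
  choose n₀ hn₀ using fun i => (T.isGradedBy_right i).bounded
  obtain ⟨b, hb⟩ := (Set.finite_range n₀).bddBelow
  exact ⟨b, fun i n hn => hn₀ i n (hn.trans_le (hb ⟨i, rfl⟩))⟩

/-- The trace of a product `o(u) o(w)` of zero modes on a homogeneous part is the sum of the
products of the traces on the tensor factors. -/
theorem subTrace_eq_sum {d : ℤ} {s : ℕ} {u : A.generated {ω'}}
    (hu : u ∈ hω'.virasoroVOA.weightSpace d) {w : A.commutant (A.generated {ω'})}
    (hw : w ∈ hω'.commutantVOA.weightSpace s) (k : ℤ) {J : ℕ}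
    (hJ : ∀ (i : S) (j : ℕ), J ≤ j → (XK i).weightSpace (h - i + ((k - j : ℤ) : ℂ)) = ⊥) :
    subTrace (X.weightSpace (h + k)) (X.mode (u : V) (d - 1) * X.mode (w : V) (s - 1)) =
      ∑ i : S, ∑ j ∈ Finset.range J, (XM i).modeTrace (i + j) (d - 1) u *
        (XK i).modeTrace (h - i + ((k - j : ℤ) : ℂ)) (s - 1) w := by
  set f : Module.End ℂ N := X.mode (u : V) (d - 1) * X.mode (w : V) (s - 1)
  have hf : ∀ (i : S) (x : M i) (y : K i), f (φ i (x ⊗ₜ y)) =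
      φ i ((XM i).mode u (d - 1) x ⊗ₜ (XK i).mode w (s - 1) y) := fun i x y => by
    rw [Module.End.mul_apply, T.mode_right, T.mode_left]
  have hM : ∀ (i : S) (ν : ℂ), ∀ x ∈ (XM i).weightSpace ν,
      (XM i).mode u (d - 1) x ∈ (XM i).weightSpace ν := fun i ν x hx =>
    (XM i).mode_mem hu _ hx (by push_cast; ring)
  have hK : ∀ (i : S) (ν : ℂ), ∀ y ∈ (XK i).weightSpace ν,
      (XK i).mode w (s - 1) y ∈ (XK i).weightSpace ν := fun i ν y hy =>
    (XK i).mode_mem hw _ hy (by push_cast; ring)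
  let Q : S → ℕ → Submodule ℂ N := fun i j => piece XM XK h φ i j (k - j)
  have hQf : ∀ i j, ∀ x ∈ Q i j, f x ∈ Q i j := by
    intro i j
    have : Q i j ≤ (Q i j).comap f := tensorImage_le fun x hx y hy => by
      rw [Submodule.mem_comap, hf]
      exact tmul_mem_tensorImage (hM i _ x hx) (hK i _ y hy)
    exact this
  have hQfin : ∀ i j, FiniteDimensional ℂ (Q i j) := fun i j => T.finiteDimensional_piece i j k
  have hQbot : ∀ i j, J ≤ j → Q i j = ⊥ := fun i j hj => by
    simp only [Q, piece, hJ i j hj, tensorImage_bot_right]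
  have hRfin : ∀ i, FiniteDimensional ℂ (⨆ j, Q i j : Submodule ℂ N) := fun i => by
    have := T.isGradedBy.finiteDimensional k
    exact Submodule.finiteDimensional_of_le (iSup_le fun j => T.piece_le i j k)
  -- Different `h'` may differ by integers, so `ω'_(1)` need not separate them; independence over
  -- `i` comes from the direct sum. For fixed `i` the eigenvalues `i + j` of `ω'_(1)` do separate
  -- the pieces.
  have hRind : iSupIndep fun i => ⨆ j, Q i j := T.iSupIndep_range.mono fun i =>
    iSup_le fun j => tensorImage_le fun x _ y _ => ⟨_, rfl⟩
  rw [_root_.subTrace_eq_sum Finset.univ hRind (by rw [T.weightSpace_eq]; simp [Q])]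
  · refine Finset.sum_congr rfl fun i _ => ?_
    have hQind : iSupIndep (Q i) := by
      have h1 := (X.mode ω' 1).eigenspaces_iSupIndep.comp (f := fun j : ℕ => (i : ℂ) + j)
        fun a b hab => Nat.cast_injective (add_left_cancel hab)
      exact h1.mono fun j => tensorImage_le fun x hx y _ =>
        Module.End.mem_eigenspace_iff.2 (T.mode_ω'_apply hx y)
    have hQsup : ⨆ j, Q i j = ⨆ j ∈ Finset.range J, Q i j := by
      refine le_antisymm (iSup_le fun j => ?_) (iSup₂_le fun j _ => le_iSup (Q i) j)
      by_cases hj : j < J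
      · exact le_iSup₂_of_le j (Finset.mem_range.2 hj) le_rfl
      · rw [hQbot i j (by omega)]
        exact bot_le
    rw [_root_.subTrace_eq_sum (Finset.range J) hQind hQsup (hQf i)]
    refine Finset.sum_congr rfl fun j _ => ?_
    have : FiniteDimensional ℂ (tensorImage (φ i) ((XM i).weightSpace (i + j))
        ((XK i).weightSpace (h - i + ((k - j : ℤ) : ℂ)))) := T.finiteDimensional_piece i j k
    have := (T.isGradedBy_right i).finiteDimensional (k - j)
    exact subTrace_tensorImage (T.injective i) (hM i _) (hK i _) fun x _ y _ => hf i x y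
  · intro i
    have : ⨆ j, Q i j ≤ (⨆ j, Q i j).comap f :=
      iSup_le fun j x hx => Submodule.mem_iSup_of_mem j (hQf i j x hx)
    exact this

/-- The zero mode is a scalar on the lowest part; the trace of `1` stands for the dimension of that
part. -/
theorem modeTrace_omegaPow (i : S) (a : ℕ) :
    (XM i).modeTrace (i : ℂ) (2 * a - 1) (hω'.virasoroVOA.omegaPow a) =
      (omegaPoly a).eval (i : ℂ) * subTrace ((XM i).weightSpace (i : ℂ)) 1 := by
  have hbot := (T.isGeneratedByHighestWeight i).weightSpace_eq_bot
  rw [WeakModule.modeTrace_apply, subTrace_congr (g := (omegaPoly a).eval (i : ℂ) • 1),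
    map_smul, smul_eq_mul]
  · intro x hx
    simpa using (XM i).mode_omegaPow_of_lowest hbot a hx

/-- If the homogeneous parts of `N` are conformal designs, then the zero modes of highest weight
vectors of `W` have trace zero on the derived parts. -/
theorem modeTrace_eq_zero [∀ i, Nontrivial (M i)] {D : A.HighestWeightDecomposition}
    (hD : D.IsNatural) {t tstar : ℕ} (ht : tstar + 2 * S.card = t + 2)
    (hdesign : ∀ k : ℤ, k ≤ 0 → D.IsConformalDesign X t (h + k)) {s : ℕ} (hs : 0 < s)
    (hst : s ≤ tstar) {w : A.commutant (A.generated {ω'})}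
    (hw : IsHighestWeightVector hω'.commutantVOA.L s w) (i : S) {k : ℤ} (hk : k ≤ 0) :
    (XK i).modeTrace (h - i + k) (s - 1) w = 0 := by
  obtain ⟨n₀, hn₀⟩ := T.exists_weightSpace_right_eq_bot
  have hwW := mem_weightSpace_of_isHighestWeightVector hw
  have hwA := hω'.coe_mem_weightSpace_of_commutantVOA hwW
  -- Induction upwards from the common lower bound `n₀` of the gradings, for all `i` simultaneously,
  -- since the equations couple all the summands.
  suffices H : ∀ (m : ℕ) (k : ℤ), k ≤ 0 → k < n₀ + m → ∀ i : S,
      (XK i).modeTrace (h - i + k) (s - 1) w = 0 from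
    H (k - n₀ + 1).toNat k hk (by omega) i
  intro m
  induction m with
  | zero =>
    intro k _ hk i
    apply subTrace_eq_zero_of_eq_zero
    rw [hn₀ i k (by simpa using hk)]
    simp
  | succ m ih =>
    intro k hk hkm i
    have hsum : ∀ a < S.card, ∑ i : S, (omegaPoly a).eval (i : ℂ) *
        (subTrace ((XM i).weightSpace (i : ℂ)) 1 *
          (XK i).modeTrace (h - i + k) (s - 1) w) = 0 := by
      intro a ha
      set u := hω'.virasoroVOA.omegaPow a
      have huU : u ∈ hω'.virasoroVOA.weightSpace ((2 * a : ℤ) : ℂ) :=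
        hω'.virasoroVOA.omegaPow_mem_weightSpace a
      have huA : (u : V) ∈ A.weightSpace ((2 * a : ℤ) : ℂ) :=
        hω'.coe_mem_weightSpace_of_virasoroVOA huU
      have hproj : D.proj (A.mode w (-1) u) = 0 :=
        hω'.proj_mode_eq_zero hD hs hw (2 * a) u u.2 (by simpa using huA)
      have hv : A.mode w (-1) u ∈ A.weightSpace ((2 * a + s : ℕ) : ℂ) :=
        A.adjoint.mode_mem hwA (-1) huA (by push_cast; ring)
      -- The bound `2a + s ≤ t` follows from `a ≤ |S| - 1`, `s ≤ tstar` and `tstar + 2 |S| = t + 2`.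
      have h1 := hdesign k hk (2 * a + s) (by omega) ⟨_, hv⟩
      rw [X.trace_zeroMode, X.trace_zeroMode] at h1
      simp only [hproj, map_zero] at h1
      have h2 := hω'.modeTrace_mode_neg_one T.isGradedBy k hs u.2 huA w.2 hwA
      rw [show (((2 * a + s : ℕ) : ℤ) - 1) = 2 * a + s - 1 by push_cast; ring, h2,
        -- For `j ≥ J` the degree `k - j` lies below `n₀`; the summand `1` keeps `j = 0` in the
        -- range.
        T.subTrace_eq_sum huU hwW k (J := (k - n₀).toNat + 1)
          (fun i j hj => hn₀ i _ (by omega))] at h1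
      rw [← h1]
      refine Finset.sum_congr rfl fun i _ => ?_
      rw [Finset.sum_eq_single 0]
      · have h3 := T.modeTrace_omegaPow i a
        simp only [Nat.cast_zero, add_zero, sub_zero]
        rw [h3, mul_assoc]
      · intro j _ hj
        rw [ih (k - j) (by omega) (by push_cast at hkm; omega) i, mul_zero]
      · simp
    have hz := mul_eq_zero.1 (eq_zero_of_sum_eval_mul_eq_zero omegaPoly monic_omegaPoly
      natDegree_omegaPoly _ hsum i)
    -- The dimension factor can be cancelled only if `M(h')_{h'}` is finite-dimensional. This is
    -- known when the part of `K` is nonzero; otherwise the trace vanishes anyway.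
    rcases eq_or_ne ((XK i).weightSpace (h - i + k)) ⊥ with hbot | hbot
    · apply subTrace_eq_zero_of_eq_zero
      rw [hbot]
      simp
    · refine hz.resolve_left ?_
      have hfin := T.finiteDimensional_piece i 0 k
      rw [piece, Nat.cast_zero, Nat.cast_zero, add_zero, sub_zero] at hfin
      have hMfin : FiniteDimensional ℂ ((XM i).weightSpace (i : ℂ)) :=
        finiteDimensional_left_of_tensorImage (T.injective i) hbot
      have hM := (T.isGeneratedByHighestWeight i).weightSpace_ne_bot
      rw [subTrace_eq_trace_restrict (f := 1) fun x hx => hx]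
      have htr : LinearMap.trace ℂ ((XM i).weightSpace (i : ℂ))
          ((1 : Module.End ℂ (M i)).restrict fun x hx => hx) = _ := LinearMap.trace_id ℂ _
      rw [htr]
      exact fun h0 => hM (Submodule.finrank_eq_zero.1 (Nat.cast_eq_zero.1 h0))

end TensorDecomposition

end VertexOperatorAlgebra


/-! ### Direct sums and the main theorem -/

/-- The projection to the component `i` annihilates the ranges of all other inclusions and recovers
elements of its own. -/
theorem iSupIndep_range_lof {𝕜 ι : Type*} [Semiring 𝕜] [DecidableEq ι] (M : ι → Type*)
    [∀ i, AddCommMonoid (M i)] [∀ i, Module 𝕜 (M i)] :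
    iSupIndep fun i => LinearMap.range (DirectSum.lof 𝕜 ι M i) := by
  refine iSupIndep_def.2 fun i => Submodule.disjoint_def.2 ?_
  rintro _ ⟨z, rfl⟩ hz
  have hle : ⨆ (j) (_ : j ≠ i), LinearMap.range (DirectSum.lof 𝕜 ι M j) ≤
      LinearMap.ker (DirectSum.component 𝕜 ι M i) := by
    refine iSup₂_le fun j hj => ?_
    rintro _ ⟨y, rfl⟩
    rw [LinearMap.mem_ker, DirectSum.component.of, dif_neg hj]
  have h0 := hle hz
  rw [LinearMap.mem_ker, DirectSum.component.lof_self] at h0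
  rw [h0, map_zero]

end

theorem theorem2p4 {V N : Type*} [AddCommGroup V] [Module ℂ V] [AddCommGroup N] [Module ℂ N]
    -- the vertex operator algebra `V`, with its natural projection `π : V → V_ω`
    (A : VertexOperatorAlgebra V) (D : A.HighestWeightDecomposition) (hD : D.IsNatural)
    -- the `V`-module `N`, graded by `ℤ + h`
    (X : A.WeakModule N) (h : ℂ) (hX : X.IsGradedBy h)
    -- `ω'` and `ω - ω'` generate commuting Virasoro subalgebras
    (ω' : V) (c' : ℂ) (hω' : A.IsVirasoroSplitting ω' c')
    -- the projection `π* : W → V_{ω - ω'}` for the commutant `W` of `U = V_{ω'}`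
    (D' : hω'.commutantVOA.HighestWeightDecomposition)
    -- the finite decomposition `N = ⨁_{h' ∈ S} M̃(h') ⊗ K(h - h')` as a `U ⊗ W`-module
    (S : Finset ℂ) (M K : S → Type*)
    [∀ i, AddCommGroup (M i)] [∀ i, Module ℂ (M i)] [∀ i, AddCommGroup (K i)] [∀ i, Module ℂ (K i)]
    (XM : ∀ i, hω'.virasoroVOA.WeakModule (M i)) (XK : ∀ i, hω'.commutantVOA.WeakModule (K i))
    (hM₀ : ∀ i, Nontrivial (M i)) (hM : ∀ i, (XM i).IsGeneratedByHighestWeight (i : ℂ))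
    (hK : ∀ i, (XK i).IsGradedBy (h - (i : ℂ)))
    (Φ : (⨁ i, M i ⊗[ℂ] K i) ≃ₗ[ℂ] N)
    (hΦU : ∀ (u : A.generated {ω'}) (n : ℤ) (i : S) (x : M i) (y : K i),
      X.mode (u : V) n (Φ (DirectSum.lof ℂ S (fun i => M i ⊗[ℂ] K i) i (x ⊗ₜ[ℂ] y))) =
        Φ (DirectSum.lof ℂ S (fun i => M i ⊗[ℂ] K i) i ((XM i).mode u n x ⊗ₜ[ℂ] y)))
    (hΦW : ∀ (w : A.commutant (A.generated {ω'})) (n : ℤ) (i : S) (x : M i) (y : K i),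
      X.mode (w : V) n (Φ (DirectSum.lof ℂ S (fun i => M i ⊗[ℂ] K i) i (x ⊗ₜ[ℂ] y))) =
        Φ (DirectSum.lof ℂ S (fun i => M i ⊗[ℂ] K i) i (x ⊗ₜ[ℂ] (XK i).mode w n y)))
    -- `t* = t + 2 - 2 s*` with `s* = |S|`
    (t tstar : ℕ) (ht : tstar + 2 * S.card = t + 2)
    -- the homogeneous parts `N_n`, `n ≤ h`, are conformal `t`-designs based on `V`
    (hdesign : ∀ k : ℕ, D.IsConformalDesign X t (h - k)) :
    -- the derived parts `K(h*)_{h* - k}`, `h* = h - h'`, are conformal `t*`-designs based on `W`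
    ∀ (i : S) (k : ℕ), D'.IsConformalDesign (XK i) tstar (h - (i : ℂ) - k) := by
  intro i k
  let φ : ∀ i, M i ⊗[ℂ] K i →ₗ[ℂ] N := fun i =>
    Φ.toLinearMap ∘ₗ DirectSum.lof ℂ S (fun i => M i ⊗[ℂ] K i) i
  have hrange : ∀ i, LinearMap.range (φ i) = (LinearMap.range
      (DirectSum.lof ℂ S (fun i => M i ⊗[ℂ] K i) i)).map Φ.toLinearMap := fun i =>
    LinearMap.range_comp _ _
  have T : VertexOperatorAlgebra.TensorDecomposition hω' X h XM XK φ :=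
    { isGradedBy := hX
      isGeneratedByHighestWeight := hM
      isGradedBy_right := hK
      injective := fun i => Φ.injective.comp (DirectSum.of_injective i)
      iSupIndep_range := by
        simp only [hrange]
        exact (iSupIndep_range_lof _).map_orderIso (Submodule.orderIsoMapComap Φ)
      iSup_range := by
        simp only [hrange]
        rw [← Submodule.map_iSup]
        exact (congrArg _ DFinsupp.iSup_range_lsingle).trans (by simp)
      mode_left := hΦU
      mode_right := hΦW }
  have hdesign' : ∀ k : ℤ, k ≤ 0 → D.IsConformalDesign X t (h + k) := by
    intro k hk
    obtain ⟨m, rfl⟩ : ∃ m : ℕ, k = -m := ⟨k.natAbs, by omega⟩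
    simpa [← sub_eq_add_neg] using hdesign m
  have hres := D'.isConformalDesign_of_highestWeight (hK i) (t := tstar)
    (fun s hs hst w hw k hk => T.modeTrace_eq_zero hD ht hdesign' hs hst hw i hk)
    (k := -k) (by omega)
  simpa [← sub_eq_add_neg] using hres
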